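/- Let $F$ be a non-archimedean local field with ring of integers $\mathcal{O}$, maximal ideal $\mathfrak{p}$ and residue field $\mathcal{O}/\mathfrak{p}\cong\mathbb{F}_q$. Let $G=GL(2,F)$, let $Z\cong F^\times$ be its center and let $K=GL(2,\mathcal{O})$. A *cuspidal* representation of $GL(2,\mathbb{F}_q)$ is an irreducible complex representation with no nonzero vector fixed by all matrices $\begin{pmatrix}1&x\\0&1\end{pmatrix}$, $x\in\mathbb{F}_q$. A *depth-zero cuspidal representation* of $G$ is a representation isomorphic to the compactly induced representation $\text{c-Ind}_{ZK}^{G}\,\pi_0$, where $\pi_0(zk)=\omega(z)\,\sigma(k \bmod \mathfrak{p})$ for $z\in Z$, $k\in K$; here $\sigma$ is a cuspidal representation of $GL(2,\mathbb{F}_q)$ and $\omega$ is a character of $Z$, with values of absolute value $1$, such that for every $u\in\mathcal{O}^\times$ the scalar matrix $u\bmod\mathfrak{p}$ acts through $\sigma$ by $\omega(u)$. (The space of $\text{c-Ind}_{ZK}^{G}\,\pi_0$ consists of the functions $f$ on $G$ with $f(hg)=\pi_0(h)f(g)$ for $h\in ZK$ that are right invariant under some open subgroup of $G$ and supported in $ZK\cdot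 C$ for some compact set $C$; $G$ acts by right translation.) Let $\mu$ be a Haar measure on $G/Z$. A representation $(\pi,V)$ of $G$, with smooth dual $(\check\pi,\check V)$, is a *discrete series representation* if it is smooth and irreducible and if, for all $v\in V$ and $\check v\in\check V$, the function $|\langle\check v,\pi(g)v\rangle|^2$ is a well-defined and integrable function on $G/Z$. Such a representation has *formal dimension* $\mathrm{d}_\pi>0$ with respect to $\mu$ if, for all $v,v'\in V$ and $\check v,\check v'\in\check V$, the integrand below is a well-defined integrable function on $G/Z$ and $$\int_{G/Z}\langle\check\pi(g)\check v,v\rangle\,\langle\check v',\pi(g)v'\rangle\,d\mu(g)=\mathrm{d}_\pi^{-1}\,\langle\check v,v'\rangle\,\langle\check v',v\rangle .$$ Let $\pi$ be a depth-zero cuspidal representation of $G$. Then: (i) if $\mu(KZ/Z)=1$, then $\pi$ is a discrete series representation and has formal dimension $\mathrm{d}_\pi=q-1$ with respect to $\mu$; (ii) if $\mu(KZ/Z)=\frac12(q-1)$, then $\pi$ is a discrete series representation and has formal dimension $\mathrm{d}_\pi=2$ with respect to $\mu$. -/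

import Mathlib

open Matrix MeasureTheory ValuativeRel

noncomputable section

/-! ### Smooth representations of topological groups

In a locally profinite group every open subgroup contains a compact open one, so for such groups
"fixed by an open subgroup" and "fixed by a compact open subgroup" are the same condition. -/

section Smooth

variable {G : Type*} [Group G] [TopologicalSpace G] {V : Type*} [AddCommGroup V] [Module ℂ V]

/-- The vectors of a representation that are fixed by some open subgroup. -/
def smoothVectors (π : Representation ℂ G V) : Submodule ℂ V where
  carrier := {v | ∃ U : Subgroup G, IsOpen (U : Set G) ∧ ∀ g ∈ U, π g v = v}
  zero_mem' := ⟨⊤, isOpen_univ, fun g _ => map_zero (π g)⟩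
  add_mem' := by
    rintro v w ⟨U, hU, hv⟩ ⟨U', hU', hw⟩
    exact ⟨U ⊓ U', hU.inter hU', fun g hg => by rw [map_add, hv g hg.1, hw g hg.2]⟩
  smul_mem' := by
    rintro c v ⟨U, hU, hv⟩
    exact ⟨U, hU, fun g hg => by rw [map_smul, hv g hg]⟩

/-- A representation is smooth if each of its vectors is fixed by an open subgroup. -/
def IsSmoothRep (π : Representation ℂ G V) : Prop := ∀ v : V, v ∈ smoothVectors π

/-- The space of the smooth dual: the smooth vectors of the full linear dual, on which `g` acts by
`⟨g • l, v⟩ = ⟨l, π g⁻¹ v⟩`. -/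
def smoothDual (π : Representation ℂ G V) : Submodule ℂ (Module.Dual ℂ V) :=
  smoothVectors π.dual

/-- `π` is a discrete series representation (with respect to the Haar measure `μ` on the quotient
of `G` by its center `Z`): it is smooth and irreducible, and for all `l` in the smooth dual and all
vectors `v`, the function `|⟨l, π(g) v⟩|²` is a function on `G / Z` (called `φ` below), which is
integrable. -/
structure IsDiscreteSeries (π : Representation ℂ G V) [MeasurableSpace (G ⧸ Subgroup.center G)]
    (μ : Measure (G ⧸ Subgroup.center G)) : Prop where
  smooth : IsSmoothRep π
  irreducible : π.IsIrreducible
  squareIntegrable : ∀ l ∈ smoothDual π, ∀ v : V, ∃ φ : G ⧸ Subgroup.center G → ℝ,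
    (∀ g : G, φ (g : G ⧸ Subgroup.center G) = ‖l (π g v)‖ ^ 2) ∧ Integrable φ μ

/-- The discrete series representation `π` has formal dimension `d`, with respect to the Haar
measure `μ` on `G / Z`: for all vectors `v, v'` and all `l, l'` in the smooth dual,
`∫_{G/Z} ⟨π^∨(g) l, v⟩ ⟨l', π(g) v'⟩ dμ(g) = d⁻¹ ⟨l, v'⟩ ⟨l', v⟩`.
The function `φ` is the integrand, as a function on `G / Z`. -/
structure HasFormalDimension (π : Representation ℂ G V) [MeasurableSpace (G ⧸ Subgroup.center G)]
    (μ : Measure (G ⧸ Subgroup.center G)) (d : ℝ) : Prop where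
  discreteSeries : IsDiscreteSeries π μ
  pos : 0 < d
  schur : ∀ l ∈ smoothDual π, ∀ l' ∈ smoothDual π, ∀ v v' : V,
    ∃ φ : G ⧸ Subgroup.center G → ℂ,
      (∀ g : G, φ (g : G ⧸ Subgroup.center G) = (π.dual g l) v * l' (π g v')) ∧
      Integrable φ μ ∧ ∫ x, φ x ∂μ = (d : ℂ)⁻¹ * (l v' * l' v)

end Smooth

/-! ### Compact induction -/

section CompactInduction

variable {G : Type*} [Group G] [TopologicalSpace G] [IsTopologicalGroup G]
  {W : Type*} [AddCommGroup W] [Module ℂ W]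

/-- The space of the compactly induced representation: functions `f : G → W` with
`f (h g) = σ(h) f(g)` for `h ∈ H`, which are right invariant under some open subgroup and whose
support lies in `H C` for some compact set `C`. -/
def compactIndSpace (H : Subgroup G) (σ : Representation ℂ H W) : Submodule ℂ (G → W) where
  carrier := {f | (∀ (h : H) (g : G), f (h * g) = σ h (f g)) ∧
    (∃ U : Subgroup G, IsOpen (U : Set G) ∧ ∀ g : G, ∀ k ∈ U, f (g * k) = f g) ∧
    ∃ C : Set G, IsCompact C ∧ ∀ g : G, f g ≠ 0 → ∃ h ∈ H, ∃ c ∈ C, g = h * c}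
  zero_mem' := ⟨fun h _ => (map_zero (σ h)).symm, ⟨⊤, isOpen_univ, fun _ _ _ => rfl⟩,
    ∅, isCompact_empty, fun _ hg => absurd rfl hg⟩
  add_mem' := by
    rintro f f' ⟨h1, ⟨U, hU, h2⟩, C, hC, h3⟩ ⟨h1', ⟨U', hU', h2'⟩, C', hC', h3'⟩
    refine ⟨fun h g => by simp [h1, h1'], ⟨U ⊓ U', hU.inter hU', fun g k hk => ?_⟩,
      C ∪ C', hC.union hC', fun g hg => ?_⟩
    · simp [h2 g k hk.1, h2' g k hk.2]
    · by_cases hf : f g = 0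
      · have hf' : f' g ≠ 0 := fun h0 => hg (by simp [hf, h0])
        obtain ⟨h, hh, c, hc, e⟩ := h3' g hf'
        exact ⟨h, hh, c, Or.inr hc, e⟩
      · obtain ⟨h, hh, c, hc, e⟩ := h3 g hf
        exact ⟨h, hh, c, Or.inl hc, e⟩
  smul_mem' := by
    rintro a f ⟨h1, ⟨U, hU, h2⟩, C, hC, h3⟩
    refine ⟨fun h g => by simp [h1], ⟨U, hU, fun g k hk => by simp [h2 g k hk]⟩,
      C, hC, fun g hg => h3 g fun h0 => hg (by simp [h0])⟩

/-- Compact induction `c-Ind_H^G σ`: the group acts on `compactIndSpace H σ` by right translation,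
`(g • f)(x) = f (x g)`. -/
def compactInd (H : Subgroup G) (σ : Representation ℂ H W) :
    Representation ℂ G (compactIndSpace H σ) where
  toFun g :=
    { toFun := fun f => ⟨fun x => f.1 (x * g), by
        obtain ⟨f, h1, ⟨U, hU, h2⟩, C, hC, h3⟩ := f
        refine ⟨fun h x => by simp [mul_assoc, h1],
          ⟨U.comap (MulAut.conj g⁻¹).toMonoidHom, ?_, fun x k hk => ?_⟩,
          (fun c => c * g⁻¹) '' C, hC.image (by fun_prop), fun x hx => ?_⟩
        · exact hU.preimage (by
            change Continuous fun x => g⁻¹ * x * g⁻¹⁻¹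
            fun_prop)
        · have hk' : g⁻¹ * k * g ∈ U := by simpa using hk
          have := h2 (x * g) _ hk'
          simpa [mul_assoc] using this
        · obtain ⟨h, hh, c, hc, e⟩ := h3 (x * g) hx
          exact ⟨h, hh, c * g⁻¹, ⟨c, hc, rfl⟩, by rw [← mul_assoc, ← e]; simp⟩⟩
      map_add' := fun _ _ => rfl
      map_smul' := fun _ _ => rfl }
  map_one' := by
    ext f x
    simp
  map_mul' g g' := by
    ext f x
    simp [mul_assoc]

end CompactInduction

/-! ### Cuspidal representations of `GL(2)` over a finite field -/

/-- A representation of `GL(2, k)` is cuspidal if it is irreducible and does not contain the trivial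
character of the group of unipotent upper triangular matrices. -/
structure IsCuspidalRep {k : Type*} [Field k] {W : Type*} [AddCommGroup W] [Module ℂ W]
    (σ : Representation ℂ (GL (Fin 2) k) W) : Prop where
  irreducible : σ.IsIrreducible
  no_fixed : ∀ w : W, (∀ x : k, σ (GeneralLinearGroup.upperRightHom x) w = w) → w = 0

/-! ### Depth-zero cuspidal representations of `GL(2)` over a local field -/

section DepthZero

variable (F : Type*) [Field F] [ValuativeRel F]

/-- The inclusion `GL(2, 𝒪) → GL(2, F)`. Its image is the maximal compact subgroup `K`. -/
def integralInclusion : GL (Fin 2) 𝒪[F] →* GL (Fin 2) F :=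
  GeneralLinearGroup.map 𝒪[F].subtype

/-- Reduction modulo the maximal ideal, `GL(2, 𝒪) → GL(2, k)`, with `k` the residue field. -/
def integralReduction : GL (Fin 2) 𝒪[F] →* GL (Fin 2) 𝓀[F] :=
  GeneralLinearGroup.map (IsLocalRing.residue 𝒪[F])

/-- The homomorphism `(z, κ) ↦ z κ` from `Fˣ × GL(2, 𝒪)` to `GL(2, F)`, where `z` is identified with
a scalar matrix. -/
def centerMulK : Fˣ × GL (Fin 2) 𝒪[F] →* GL (Fin 2) F where
  toFun p := GeneralLinearGroup.scalar (Fin 2) p.1 * integralInclusion F p.2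
  map_one' := by simp
  map_mul' p p' := by
    have h : GeneralLinearGroup.scalar (Fin 2) p'.1 * integralInclusion F p.2 =
        integralInclusion F p.2 * GeneralLinearGroup.scalar (Fin 2) p'.1 := by
      ext i j
      simp [GeneralLinearGroup.scalar, mul_comm]
    simp only [Prod.fst_mul, Prod.snd_mul, map_mul]
    rw [mul_assoc, mul_assoc, ← mul_assoc (GeneralLinearGroup.scalar (Fin 2) p'.1), h, mul_assoc]

/-- The subgroup `Z K` of `GL(2, F)`. -/
def subgroupZK : Subgroup (GL (Fin 2) F) := (centerMulK F).range

/-- The image `K.Z/Z` of `K` in `GL(2, F) / Z`. -/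
def imageKModZ : Set (GL (Fin 2) F ⧸ Subgroup.center (GL (Fin 2) F)) :=
  (fun g : GL (Fin 2) F => (g : GL (Fin 2) F ⧸ Subgroup.center (GL (Fin 2) F))) ''
    (subgroupZK F : Set (GL (Fin 2) F))

variable {F} {W : Type*} [AddCommGroup W] [Module ℂ W]

/-- The unitary character `ω` of `Fˣ` extends the central character of the inflation of `σ` to
`K`: a scalar matrix `u` with `u ∈ 𝒪ˣ` acts through `σ` by `ω u`. -/
def ExtendsCentralChar (σ : Representation ℂ (GL (Fin 2) 𝓀[F]) W) (ω : Fˣ →* Circle) : Prop :=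
  ∀ (u : 𝒪[F]ˣ) (w : W),
    σ (integralReduction F (GeneralLinearGroup.scalar (Fin 2) u)) w =
      (ω (Units.map 𝒪[F].subtype.toMonoidHom u) : ℂ) • w

/-- The representation `(z, κ) ↦ ω(z) σ(κ mod 𝔭)` of `Fˣ × GL(2, 𝒪)`. -/
def productRep (σ : Representation ℂ (GL (Fin 2) 𝓀[F]) W) (ω : Fˣ →* Circle) :
    Representation ℂ (Fˣ × GL (Fin 2) 𝒪[F]) W where
  toFun p := (ω p.1 : ℂ) • σ (integralReduction F p.2)
  map_one' := by simp
  map_mul' p p' := by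
    ext w
    simp [smul_smul, mul_comm]

lemma centerMulK_ker_le (σ : Representation ℂ (GL (Fin 2) 𝓀[F]) W) (ω : Fˣ →* Circle)
    (h : ExtendsCentralChar σ ω) : (centerMulK F).ker ≤ (productRep σ ω).ker := by
  rintro ⟨z, κ⟩ hp
  have hp' : GeneralLinearGroup.scalar (Fin 2) z * integralInclusion F κ = 1 := hp
  have entry : ∀ i j, ((κ i j : 𝒪[F]) : F) = if i = j then ((z⁻¹ : Fˣ) : F) else 0 := by
    intro i j
    have e : integralInclusion F κ = GeneralLinearGroup.scalar (Fin 2) z⁻¹ := by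
      rw [map_inv]
      exact eq_inv_of_mul_eq_one_right hp'
    have e' := congrArg (fun g : GL (Fin 2) F => g i j) e
    simpa [integralInclusion, GeneralLinearGroup.scalar, Matrix.diagonal_apply] using e'
  have hk : ∀ i j, κ i j = if i = j then κ 0 0 else 0 := by
    intro i j
    apply Subtype.ext
    rw [entry]
    split_ifs with hij
    · rw [entry 0 0, if_pos rfl]
    · rfl
  have hdet : κ 0 0 * κ 0 0 = (GeneralLinearGroup.det κ : 𝒪[F]) := by
    have h11 := hk 1 1
    have h01 := hk 0 1
    simp only [if_true, Fin.isValue, zero_ne_one, if_false] at h11 h01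
    rw [GeneralLinearGroup.val_det_apply, Matrix.det_fin_two, h11, h01]
    ring
  have hu : IsUnit (κ 0 0) :=
    isUnit_of_mul_isUnit_left (hdet ▸ (GeneralLinearGroup.det κ).isUnit)
  obtain ⟨u, hu⟩ := hu
  have hκ : κ = GeneralLinearGroup.scalar (Fin 2) u := by
    ext i j
    rw [hk i j, ← hu]
    simp [GeneralLinearGroup.scalar, Matrix.diagonal_apply]
  have hz : Units.map 𝒪[F].subtype.toMonoidHom u = z⁻¹ := by
    ext
    have := entry 0 0
    rw [if_pos rfl, ← hu] at this
    exact this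
  refine MonoidHom.mem_ker.mpr (LinearMap.ext fun w => ?_)
  change (ω z : ℂ) • σ (integralReduction F κ) w = w
  rw [hκ, h u w, hz, smul_smul, ← Circle.coe_mul, ← map_mul]
  simp

/-- The representation `z κ ↦ ω(z) σ(κ mod 𝔭)` of `Z K`, for `z ∈ Z` and `κ ∈ K`. -/
def extendToZK (σ : Representation ℂ (GL (Fin 2) 𝓀[F]) W) (ω : Fˣ →* Circle)
    (h : ExtendsCentralChar σ ω) : Representation ℂ (subgroupZK F) W :=
  (QuotientGroup.lift (centerMulK F).ker (productRep σ ω) (centerMulK_ker_le σ ω h)).comp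
    (QuotientGroup.quotientKerEquivRange (centerMulK F)).symm.toMonoidHom

lemma extendToZK_apply (σ : Representation ℂ (GL (Fin 2) 𝓀[F]) W) (ω : Fˣ →* Circle)
    (h : ExtendsCentralChar σ ω) (z : Fˣ) (κ : GL (Fin 2) 𝒪[F]) :
    extendToZK σ ω h ⟨centerMulK F (z, κ), (z, κ), rfl⟩ =
      (ω z : ℂ) • σ (integralReduction F κ) := by
  have e : (QuotientGroup.quotientKerEquivRange (centerMulK F)).symm
      ⟨centerMulK F (z, κ), (z, κ), rfl⟩ = QuotientGroup.mk (z, κ) := by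
    rw [MulEquiv.symm_apply_eq]
    rfl
  exact congrArg
    (QuotientGroup.lift (centerMulK F).ker (productRep σ ω) (centerMulK_ker_le σ ω h)) e

/-- A representation of `GL(2, F)` is a depth-zero cuspidal representation if it is isomorphic to
`c-Ind_{ZK}^{G} π₀`, where `π₀` is obtained from a cuspidal representation `σ` of `GL(2)` over the
residue field by inflating `σ` to `K` and by extending its central character to a unitary
character `ω` of the center. (Irreducible representations of a finite group are finite-dimensional,
so `σ` may be taken to act on some `ℂⁿ`.) -/
def IsDepthZeroCuspidal [TopologicalSpace F] [IsNonarchimedeanLocalField F]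
    {V : Type*} [AddCommGroup V] [Module ℂ V] (π : Representation ℂ (GL (Fin 2) F) V) : Prop :=
  ∃ (n : ℕ) (σ : Representation ℂ (GL (Fin 2) 𝓀[F]) (Fin n → ℂ)) (ω : Fˣ →* Circle)
    (h : ExtendsCentralChar σ ω), IsCuspidalRep σ ∧
      Nonempty (π.Equiv (compactInd (subgroupZK F) (extendToZK σ ω h)))

end DepthZero

end

/-! Let `H` be an open subgroup containing the center `Z` and compact modulo `Z`. If a
finite-dimensional `ρ` of `H` induces cuspidally to `G`, and right translation preserves the volume
of `H/Z`, then the formal dimension of the induced representation is `dim ρ / μ(H/Z)`. For `H = ZK`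
it remains to know that `dim σ = q - 1`.

The dimension (`IsCuspidalRep.finrank_add_one`) comes from restricting `σ` to the unipotent group.
The trivial character does not occur, the `q - 1` others are permuted transitively by diagonal
matrices, and each has multiplicity one because the Gelfand-Graev Hecke algebra acts commutatively.

Cuspidality reaches `G` through the Cartan decomposition `g = z k₁ diag(1,δ) k₂`. When `|δ| < 1`,
conjugation by `g⁻¹` shrinks `k₁ N(𝒪) k₁⁻¹`, whereas `σ` sums to zero over `N(𝔽_q)`. Hence a vector
or linear form fixed by the shrunken group vanishes at `g`. Vectors fixed by the congruence subgroup
thus live on `ZK`, which gives irreducibility, and matrix coefficients have compact support modulo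
`Z`, which gives square integrability. `IsCuspidalInducing` isolates what this argument needs.

For Schur orthogonality (`integral_schurFun`), a smooth form `l` becomes a function `λ` on `G` with
values in the dual of `W`. The operator `w ↦ ∫ λ(g)(w) v(g) dg` commutes with `ρ`, so it is a
scalar, and unimodularity gives its trace as `μ(H/Z) l(v)`. Dividing by `dim ρ` gives the constant.
-/

noncomputable section

/-! ### Cuspidal representations of `GL(2)` over a finite field: multiplicity one and dimension. -/

section FiniteField

variable {k : Type*} [Field k] {W : Type*} [AddCommGroup W] [Module ℂ W]

/-- Reflection of a `2 × 2` matrix in its antidiagonal. -/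
def antitranspose (g : GL (Fin 2) k) : GL (Fin 2) k :=
  GeneralLinearGroup.mkOfDetNeZero !![g 1 1, g 0 1; g 1 0, g 0 0] (by
    have := g.det_ne_zero
    rw [Matrix.det_fin_two] at this
    rw [Matrix.det_fin_two_of]
    convert this using 1
    ring)

lemma antitranspose_mul (g h : GL (Fin 2) k) :
    antitranspose (g * h) = antitranspose h * antitranspose g := by
  ext i j
  fin_cases i <;> fin_cases j <;>
    simp [antitranspose, Matrix.mul_apply, Fin.sum_univ_two] <;> ring

lemma antitranspose_upperRightHom (x : k) :
    antitranspose (GeneralLinearGroup.upperRightHom x) = GeneralLinearGroup.upperRightHom x := by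
  ext i j
  fin_cases i <;> fin_cases j <;> simp [antitranspose]

variable [Fintype k] (σ : Representation ℂ (GL (Fin 2) k) W)

/-- The projection onto the `ψ`-isotypic part for the group of unipotent upper triangular
matrices. -/
def whittakerProj (ψ : AddChar k ℂ) : W →ₗ[ℂ] W :=
  (Fintype.card k : ℂ)⁻¹ • ∑ x : k, ψ (-x) • σ (GeneralLinearGroup.upperRightHom x)

variable {σ} {ψ : AddChar k ℂ}

lemma upperRightHom_mul_whittakerProj (y : k) :
    σ (GeneralLinearGroup.upperRightHom y) * whittakerProj σ ψ = ψ y • whittakerProj σ ψ := by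
  simp only [whittakerProj, mul_smul_comm, Finset.mul_sum, ← map_mul, ← AddChar.map_add_eq_mul]
  rw [smul_comm (ψ y), Finset.smul_sum (r := ψ y),
    ← Equiv.sum_comp (Equiv.addLeft y)
      (fun x => ψ y • ψ (-x) • σ (GeneralLinearGroup.upperRightHom x))]
  congr 1
  refine Finset.sum_congr rfl fun x _ => ?_
  rw [smul_smul (ψ y), ← AddChar.map_add_eq_mul]
  simp

lemma whittakerProj_mul_upperRightHom (y : k) :
    whittakerProj σ ψ * σ (GeneralLinearGroup.upperRightHom y) = ψ y • whittakerProj σ ψ := by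
  rw [← upperRightHom_mul_whittakerProj]
  simp only [whittakerProj, mul_smul_comm, smul_mul_assoc, Finset.mul_sum, Finset.sum_mul,
    ← map_mul, ← AddChar.map_add_eq_mul, add_comm]

lemma whittakerProj_mul_self : whittakerProj σ ψ * whittakerProj σ ψ = whittakerProj σ ψ := by
  conv_lhs => enter [1]; rw [whittakerProj]
  rw [smul_mul_assoc, Finset.sum_mul]
  simp_rw [smul_mul_assoc, upperRightHom_mul_whittakerProj, smul_smul,
    ← AddChar.map_add_eq_mul, neg_add_cancel, AddChar.map_zero_eq_one, one_smul]
  rw [Finset.sum_const, Finset.card_univ, ← Nat.cast_smul_eq_nsmul ℂ, smul_smul,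
    inv_mul_cancel₀ (by simp), one_smul]

variable (σ ψ) in
/-- The element `e g e` of the Hecke algebra of the Gelfand-Graev representation, acting on `σ`. -/
def heckeOp (g : GL (Fin 2) k) : W →ₗ[ℂ] W := whittakerProj σ ψ * σ g * whittakerProj σ ψ

lemma heckeOp_left_mul (x : k) (g : GL (Fin 2) k) :
    heckeOp σ ψ (GeneralLinearGroup.upperRightHom x * g) = ψ x • heckeOp σ ψ g := by
  rw [heckeOp, map_mul, ← mul_assoc, whittakerProj_mul_upperRightHom, smul_mul_assoc,
    smul_mul_assoc, heckeOp]

lemma heckeOp_right_mul (x : k) (g : GL (Fin 2) k) :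
    heckeOp σ ψ (g * GeneralLinearGroup.upperRightHom x) = ψ x • heckeOp σ ψ g := by
  rw [heckeOp, map_mul, mul_assoc, mul_assoc, upperRightHom_mul_whittakerProj,
    mul_smul_comm, mul_smul_comm, heckeOp, mul_assoc]

lemma heckeOp_eq_zero (hψ : ψ ≠ 1) (g : GL (Fin 2) k) (hc : g 1 0 = 0) (had : g 0 0 ≠ g 1 1) :
    heckeOp σ ψ g = 0 := by
  obtain ⟨y, hy⟩ := AddChar.ne_one_iff.mp hψ
  have key (x : k) : GeneralLinearGroup.upperRightHom (x * g 0 0) * g =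
      g * GeneralLinearGroup.upperRightHom (x * g 1 1) := by
    ext i j
    fin_cases i <;> fin_cases j <;> simp [Matrix.mul_apply, Fin.sum_univ_two, hc]
    ring
  -- The parameter is chosen so that the two unipotent factors differ by exactly `y`, where `ψ y ≠
  -- 1`.
  have h := congrArg (heckeOp σ ψ) (key (y / (g 0 0 - g 1 1)))
  rw [heckeOp_left_mul, heckeOp_right_mul, ← sub_eq_zero, ← sub_smul] at h
  refine (smul_eq_zero.mp h).resolve_left fun h0 => hy ?_
  have e : y = y / (g 0 0 - g 1 1) * g 0 0 - y / (g 0 0 - g 1 1) * g 1 1 := by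
    rw [← mul_sub, div_mul_cancel₀ _ (sub_ne_zero.mpr had)]
  rw [e, AddChar.map_sub_eq_div, sub_eq_zero.mp h0,
      div_self (AddChar.val_isUnit ψ _).ne_zero]

/-- Bruhat decomposition. On the big cell the reflection is `u(t) g u(-t)`, and the factors `ψ(t)`,
`ψ(-t)` cancel. On the Borel subgroup either `g` is its own reflection or both operators vanish. -/
lemma heckeOp_antitranspose (hψ : ψ ≠ 1) (g : GL (Fin 2) k) :
    heckeOp σ ψ (antitranspose g) = heckeOp σ ψ g := by
  by_cases hc : g 1 0 = 0
  · by_cases had : g 0 0 = g 1 1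
    · congr 1
      ext i j
      fin_cases i <;> fin_cases j <;> simp [antitranspose, had]
    · rw [heckeOp_eq_zero hψ g hc had, heckeOp_eq_zero hψ]
      · simpa [antitranspose] using hc
      · simpa [antitranspose] using fun h => had h.symm
  · have e : antitranspose g = GeneralLinearGroup.upperRightHom ((g 1 1 - g 0 0) / g 1 0) *
        (g * GeneralLinearGroup.upperRightHom (-((g 1 1 - g 0 0) / g 1 0))) := by
      ext i j
      fin_cases i <;> fin_cases j <;>
        simp [antitranspose, Matrix.mul_apply, Fin.sum_univ_two] <;> field_simp <;> ring
    rw [e, heckeOp_left_mul, heckeOp_right_mul, smul_smul, ← AddChar.map_add_eq_mul]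
    simp

lemma heckeOp_mul (g h : GL (Fin 2) k) :
    heckeOp σ ψ g * heckeOp σ ψ h = (Fintype.card k : ℂ)⁻¹ • ∑ x : k, ψ (-x) •
      heckeOp σ ψ (g * GeneralLinearGroup.upperRightHom x * h) := by
  have : heckeOp σ ψ g * heckeOp σ ψ h =
      whittakerProj σ ψ * σ g * whittakerProj σ ψ * σ h * whittakerProj σ ψ := by
    simp only [heckeOp, mul_assoc]
    rw [← mul_assoc (whittakerProj σ ψ) (whittakerProj σ ψ), whittakerProj_mul_self]
  rw [this]
  conv_lhs => enter [1, 1, 2]; rw [whittakerProj]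
  simp only [heckeOp, map_mul, mul_assoc, mul_smul_comm, smul_mul_assoc, Finset.mul_sum,
    Finset.sum_mul]

/-- Gelfand's trick: the reflection reverses products, fixes the unipotent group pointwise, and
leaves every `heckeOp` unchanged. -/
lemma heckeOp_comm (hψ : ψ ≠ 1) (g h : GL (Fin 2) k) :
    heckeOp σ ψ g * heckeOp σ ψ h = heckeOp σ ψ h * heckeOp σ ψ g := by
  rw [heckeOp_mul, ← heckeOp_antitranspose hψ g, ← heckeOp_antitranspose hψ h, heckeOp_mul]
  congr 1
  refine Finset.sum_congr rfl fun x _ => ?_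
  rw [← heckeOp_antitranspose hψ (g * _ * h), antitranspose_mul, antitranspose_mul,
    antitranspose_upperRightHom, mul_assoc]

/-- The vectors generated by a nonzero vector span an irreducible representation. -/
lemma span_orbit_eq_top {G V : Type*} [Group G] [AddCommGroup V] [Module ℂ V]
    {ρ : Representation ℂ G V} (hρ : ρ.IsIrreducible) {v : V} (hv : v ≠ 0) :
    Submodule.span ℂ (Set.range fun g => ρ g v) = ⊤ := by
  let S : Subrepresentation ρ :=
    { toSubmodule := Submodule.span ℂ (Set.range fun g => ρ g v)
      apply_mem_toSubmodule := fun g w hw => by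
        have : Submodule.span ℂ (Set.range fun g => ρ g v) ≤
            (Submodule.span ℂ (Set.range fun g => ρ g v)).comap (ρ g) := by
          rw [Submodule.span_le]
          rintro _ ⟨h, rfl⟩
          exact Submodule.subset_span ⟨g * h, by simp⟩
        exact this hw }
  have hS : S ≠ ⊥ := fun h => hv <| by
    have : v ∈ S.toSubmodule := Submodule.subset_span ⟨1, by simp⟩
    rw [h] at this
    exact (Submodule.mem_bot ℂ).mp this
  have := (hρ.eq_bot_or_eq_top S).resolve_left hS
  exact congrArg Subrepresentation.toSubmodule this

/-- By irreducibility the Hecke operators carry any nonzero vector of the range to a spanning set.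
Since they commute, each is a scalar there, so one vector already spans. -/
lemma finrank_range_whittakerProj [FiniteDimensional ℂ W] (hσ : σ.IsIrreducible) (hψ : ψ ≠ 1)
    (h0 : whittakerProj σ ψ ≠ 0) :
    Module.finrank ℂ (LinearMap.range (whittakerProj σ ψ)) = 1 := by
  set e := whittakerProj σ ψ with he
  have hfix : ∀ u ∈ LinearMap.range e, e u = u := by
    rintro _ ⟨u, rfl⟩
    exact LinearMap.congr_fun (whittakerProj_mul_self (σ := σ) (ψ := ψ)) u
  have hspan : ∀ u ∈ LinearMap.range e, u ≠ 0 → LinearMap.range e ≤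
      Submodule.span ℂ (Set.range fun g => heckeOp σ ψ g u) := by
    intro u hu hu0
    rw [LinearMap.range_eq_map, ← span_orbit_eq_top hσ hu0, Submodule.map_span, Submodule.span_le]
    rintro _ ⟨_, ⟨g, rfl⟩, rfl⟩
    refine Submodule.subset_span ⟨g, ?_⟩
    simp only [heckeOp, Module.End.mul_apply]
    rw [← he, hfix u hu]
  have hmem : ∀ g u, heckeOp σ ψ g u ∈ LinearMap.range e := fun g u => ⟨_, rfl⟩
  have hscalar : ∀ g, ∃ c : ℂ, ∀ u ∈ LinearMap.range e, heckeOp σ ψ g u = c • u := by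
    intro g
    have : Nontrivial (LinearMap.range e) := by
      rw [Submodule.nontrivial_iff_ne_bot]
      exact fun h => h0 (LinearMap.range_eq_bot.mp h)
    obtain ⟨c, hc⟩ := Module.End.exists_eigenvalue
      ((heckeOp σ ψ g).restrict (p := LinearMap.range e) (q := LinearMap.range e)
        fun u _ => hmem g u)
    obtain ⟨⟨u, hu⟩, hcu⟩ := hc.exists_hasEigenvector
    have hu0 : u ≠ 0 := fun h => hcu.2 (Subtype.ext h)
    have hgu : heckeOp σ ψ g u = c • u := congrArg Subtype.val hcu.apply_eq_smul
    -- The eigenvalue spreads from `u` to the whole range: the vectors `heckeOp σ ψ h u` span it,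
    -- and each lies in the same eigenspace by commutativity.
    refine ⟨c, fun w hw => ?_⟩
    refine Submodule.span_induction ?_ (by simp) (fun x y _ _ hx hy => by rw [map_add, hx, hy,
      smul_add]) (fun a x _ hx => by rw [map_smul, hx, smul_comm]) (hspan u hu hu0 hw)
    rintro _ ⟨h, rfl⟩
    have := LinearMap.congr_fun (heckeOp_comm (σ := σ) hψ g h) u
    simp only [Module.End.mul_apply] at this
    rw [this, hgu, map_smul]
  obtain ⟨u, hu, hu0⟩ := (Submodule.ne_bot_iff _).mp fun h => h0 (LinearMap.range_eq_bot.mp h)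
  refine finrank_eq_one ⟨u, hu⟩ (fun h => hu0 (congrArg Subtype.val h)) fun ⟨w, hw⟩ => ?_
  have hle : Submodule.span ℂ (Set.range fun g => heckeOp σ ψ g u) ≤ ℂ ∙ u := by
    rw [Submodule.span_le]
    rintro _ ⟨g, rfl⟩
    obtain ⟨c, hc⟩ := hscalar g
    exact Submodule.mem_span_singleton.mpr ⟨c, (hc u hu).symm⟩
  obtain ⟨c, hc⟩ := Submodule.mem_span_singleton.mp (hle (hspan u hu hu0 hw))
  exact ⟨c, Subtype.ext hc⟩

/-- The shifts of a nontrivial `ψ` run over all additive characters, so orthogonality leaves only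
the term at `x = 0`. -/
lemma sum_whittakerProj_mulShift (hψ : ψ ≠ 1) :
    ∑ a : k, whittakerProj σ (ψ.mulShift a) = 1 := by
  classical
  simp only [whittakerProj, ← Finset.smul_sum]
  rw [Finset.sum_comm]
  have : ∀ x : k, ∑ a : k, ψ.mulShift a (-x) • σ (GeneralLinearGroup.upperRightHom x) =
      if x = 0 then (Fintype.card k : ℂ) • 1 else 0 := by
    intro x
    rw [← Finset.sum_smul]
    have := AddChar.sum_mulShift (-x) (AddChar.IsPrimitive.of_ne_one hψ)
    simp only [AddChar.mulShift_apply]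
    rw [this]
    split_ifs with h1 h2 h2
    · simp [h2]
    · simp_all
    · simp_all
    · simp
  rw [Finset.sum_congr rfl fun x _ => this x, Finset.sum_ite_eq' , if_pos (Finset.mem_univ _),
    smul_smul, inv_mul_cancel₀ (by simp), one_smul]

/-- The two projections are conjugate under `diag(a, 1)`. -/
lemma trace_whittakerProj_mulShift (a : kˣ) :
    LinearMap.trace ℂ W (whittakerProj σ (ψ.mulShift a)) =
      LinearMap.trace ℂ W (whittakerProj σ ψ) := by
  let t : GL (Fin 2) k := GeneralLinearGroup.mkOfDetNeZero !![(a : k), 0; 0, 1] (by simp)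
  have ht (x : k) : t * GeneralLinearGroup.upperRightHom x =
      GeneralLinearGroup.upperRightHom (a * x) * t := by
    ext i j
    fin_cases i <;> fin_cases j <;> simp [t, Matrix.mul_apply, Fin.sum_univ_two]
  have h : whittakerProj σ (ψ.mulShift a) = σ t⁻¹ * (whittakerProj σ ψ * σ t) := by
    rw [whittakerProj, whittakerProj, smul_mul_assoc, mul_smul_comm,
      ← Equiv.sum_comp a.mulLeft (fun x => ψ (-x) • σ (GeneralLinearGroup.upperRightHom x)),
      Finset.sum_mul, Finset.mul_sum]
    congr 1
    refine Finset.sum_congr rfl fun x _ => ?_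
    rw [smul_mul_assoc, mul_smul_comm, Units.mulLeft_apply, ← map_mul, ← ht, ← map_mul,
      inv_mul_cancel_left]
    simp
  rw [h, LinearMap.trace_mul_comm, mul_assoc, ← map_mul, mul_inv_cancel, map_one, mul_one]

/-- A cuspidal representation of `GL(2)` over a finite field with `q` elements has dimension
`q - 1`. -/
theorem IsCuspidalRep.finrank_add_one [FiniteDimensional ℂ W] (hσ : IsCuspidalRep σ) :
    Module.finrank ℂ W + 1 = Fintype.card k := by
  classical
  obtain ⟨ψ, hψ'⟩ := (AddChar.exists_apply_ne_zero (α := k) (a := 1)).mpr one_ne_zero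
  have hψ : ψ ≠ 1 := fun h => hψ' (by simp [h])
  have hzero : whittakerProj σ (ψ.mulShift 0) = 0 := by
    ext w
    refine hσ.no_fixed _ fun x => ?_
    have := LinearMap.congr_fun
      (upperRightHom_mul_whittakerProj (σ := σ) (ψ := ψ.mulShift 0) x) w
    simpa using this
  have hone : (1 : Module.End ℂ W) ≠ 0 := by
    intro h
    have := hσ.irreducible.exists_pair_ne
    obtain ⟨S, T, hST⟩ := this
    refine hST (Subrepresentation.toSubmodule_injective ?_)
    have : Subsingleton W := ⟨fun a b => by
      rw [← Module.End.one_apply (R := ℂ) a, ← Module.End.one_apply (R := ℂ) b, h]; rfl⟩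
    exact Subsingleton.elim _ _
  -- Taking traces in the resolution of the identity gives `dim W = (q - 1) tr e`, where the trace
  -- of the idempotent `e` is its rank, namely one.
  have hfr := LinearMap.trace_one ℂ W
  rw [← sum_whittakerProj_mulShift hψ, map_sum,
    ← Finset.add_sum_erase _ _ (Finset.mem_univ (0 : k)), hzero, map_zero, zero_add,
    Finset.sum_congr rfl (g := fun _ => LinearMap.trace ℂ W (whittakerProj σ ψ))
      (fun a ha => trace_whittakerProj_mulShift (Units.mk0 a (Finset.ne_of_mem_erase ha))),
    Finset.sum_const, Finset.card_erase_of_mem (Finset.mem_univ _), Finset.card_univ] at hfr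
  have he : whittakerProj σ ψ ≠ 0 := by
    intro h
    rw [h, map_zero, smul_zero] at hfr
    have h0 : Module.finrank ℂ W = 0 := by exact_mod_cast hfr.symm
    have := Module.finrank_zero_iff.mp h0
    exact hone (Subsingleton.elim _ _)
  have htr : LinearMap.trace ℂ W (whittakerProj σ ψ) = 1 := by
    rw [(LinearMap.isProj_range_iff_isIdempotentElem (whittakerProj σ ψ)).mpr
      whittakerProj_mul_self |>.trace, finrank_range_whittakerProj hσ.irreducible hψ he,
      Nat.cast_one]
  rw [htr, nsmul_eq_mul, mul_one] at hfr
  have h1 : 1 ≤ Fintype.card k := Fintype.card_pos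
  have : Fintype.card k - 1 = Module.finrank ℂ W := by exact_mod_cast hfr
  omega

end FiniteField

/-! ### Averaging over compact subgroups. -/

section Averaging

variable {G : Type*} [Group G] [TopologicalSpace G] [IsTopologicalGroup G]
  {V : Type*} [AddCommGroup V] [Module ℂ V]

/-- Averaging a smooth vector over a compact subgroup. -/
lemma exists_finset_sum_fixed (π : Representation ℂ G V) {K₁ : Subgroup G}
    (hK : IsCompact (K₁ : Set G)) {v : V} (hv : v ∈ smoothVectors π) :
    ∃ T : Finset G, T.Nonempty ∧ (∀ t ∈ T, t ∈ K₁) ∧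
      ∀ k ∈ K₁, π k (∑ t ∈ T, π t v) = ∑ t ∈ T, π t v := by
  classical
  obtain ⟨U, hU, hfix⟩ := hv
  have : CompactSpace K₁ := isCompact_iff_compactSpace.mp hK
  have hopen : IsOpen ((U.subgroupOf K₁ : Subgroup K₁) : Set K₁) :=
    hU.preimage continuous_subtype_val
  have : Finite (K₁ ⧸ U.subgroupOf K₁) := Subgroup.quotient_finite_of_isOpen _ hopen
  have := Fintype.ofFinite (K₁ ⧸ U.subgroupOf K₁)
  -- A transversal of the finite quotient `K₁/(K₁ ∩ U)`. Left translation permutes the cosets, and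
  -- the change of representative lies in `U`, which fixes `v`. The sum is not normalized, so
  -- factors `T.card` appear in its uses.
  let s : K₁ ⧸ U.subgroupOf K₁ → G := fun x => (x.out : K₁)
  have hs : Function.Injective s := fun x y h => by
    have : x.out = y.out := Subtype.ext h
    rw [← x.out_eq, ← y.out_eq, this]
  have hsum : ∑ t ∈ Finset.univ.image s, π t v = ∑ x, π (s x) v :=
    Finset.sum_image fun x _ y _ h => hs h
  refine ⟨Finset.univ.image s, Finset.univ_nonempty.image _, ?_, fun k hk => ?_⟩
  · simp only [Finset.mem_image, Finset.mem_univ, true_and]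
    rintro _ ⟨x, rfl⟩
    exact x.out.2
  · rw [hsum, map_sum, ← Equiv.sum_comp (MulAction.toPerm (⟨k, hk⟩ : K₁)) fun x => π (s x) v]
    refine Finset.sum_congr rfl fun x _ => ?_
    have hmem : (((⟨k, hk⟩ : K₁) • x).out)⁻¹ * (⟨k, hk⟩ * x.out) ∈ U.subgroupOf K₁ := by
      rw [← QuotientGroup.eq, QuotientGroup.out_eq']
      conv_lhs => rw [← QuotientGroup.out_eq' x]
      rfl
    have := hfix _ (Subgroup.mem_subgroupOf.mp hmem)
    rw [MulAction.toPerm_apply, ← Module.End.mul_apply, ← map_mul]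
    conv_lhs => rw [show k * s x = s ((⟨k, hk⟩ : K₁) • x) *
      ((s ((⟨k, hk⟩ : K₁) • x))⁻¹ * (k * s x)) by group]
    rw [map_mul, Module.End.mul_apply]
    congr 1

end Averaging

/-! ### Compact induction from a cuspidal inducing datum: irreducibility and matrix coefficients. -/

section CompactInduction

variable {G : Type*} [Group G] [TopologicalSpace G] [IsTopologicalGroup G]
  {W : Type*} [AddCommGroup W] [Module ℂ W]

/-- An irreducible representation `ρ` of an open subgroup `H`, trivial on a compact open subgroup
`K₁` and with unitary central character, which is cuspidal in the following sense: for `g` outside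
of `H` (respectively, outside of a set which is compact modulo `H`), a sum of operators `ρ h` with
`h ∈ H ∩ g K₁ g⁻¹` (respectively `h ∈ H ∩ g U g⁻¹` with `U` a given open subgroup) vanishes. -/
structure IsCuspidalInducing (H K₁ : Subgroup G) (ρ : Representation ℂ H W) : Prop where
  isOpen : IsOpen (K₁ : Set G)
  isCompact : IsCompact (K₁ : Set G)
  le : K₁ ≤ H
  trivial_on : ∀ h : H, (h : G) ∈ K₁ → ρ h = 1
  irreducible : ρ.IsIrreducible
  center_le : Subgroup.center G ≤ H
  central : ∀ z : H, (z : G) ∈ Subgroup.center G → ∃ c : ℂ, ‖c‖ = 1 ∧ ρ z = c • 1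
  compact_mod : IsCompact ((fun g : G => (g : G ⧸ Subgroup.center G)) '' (H : Set G))
  exists_sum_eq_zero : ∀ g ∉ H, ∃ S : Finset H, S.Nonempty ∧
    (∀ h ∈ S, g⁻¹ * h * g ∈ K₁) ∧ ∑ h ∈ S, ρ h = 0
  exists_compact : ∀ U : Subgroup G, IsOpen (U : Set G) → ∃ C : Set G, IsCompact C ∧
    ∀ g : G, (∃ h ∈ H, ∃ c ∈ C, g = h * c) ∨ ∃ S : Finset H, S.Nonempty ∧
      (∀ h ∈ S, g⁻¹ * h * g ∈ U) ∧ ∑ h ∈ S, ρ h = 0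

variable {H K₁ : Subgroup G} {ρ : Representation ℂ H W}

lemma compactInd_apply (g x : G) (f : compactIndSpace H ρ) :
    (compactInd H ρ g f).1 x = f.1 (x * g) := rfl

lemma compactInd_smooth : IsSmoothRep (compactInd H ρ) := by
  rintro ⟨f, h1, ⟨U, hU, h2⟩, h3⟩
  exact ⟨U, hU, fun g hg => Subtype.ext (funext fun x => h2 x g hg)⟩

omit [IsTopologicalGroup G] in
lemma compactIndSpace_left (f : compactIndSpace H ρ) (h : H) (x : G) :
    f.1 (h * x) = ρ h (f.1 x) := f.2.1 h x

-- For `h ∈ S`, `ρ(h) f(g) = f(hg) = f(g · g⁻¹hg) = f(g)`; summing over `S` gives `|S| f(g) = 0`.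
omit [IsTopologicalGroup G] in
lemma eq_zero_of_sum_eq_zero (f : compactIndSpace H ρ) {U : Subgroup G} {g : G}
    (hf : ∀ u ∈ U, f.1 (g * u) = f.1 g) {S : Finset H} (hS : S.Nonempty)
    (hSU : ∀ h ∈ S, g⁻¹ * h * g ∈ U) (h0 : ∑ h ∈ S, ρ h = 0) : f.1 g = 0 := by
  have h1 : ∀ h ∈ S, ρ h (f.1 g) = f.1 g := fun h hh => by
    rw [← compactIndSpace_left, ← hf _ (hSU h hh)]
    group
  have h2 := LinearMap.congr_fun h0 (f.1 g)
  rw [LinearMap.sum_apply, Finset.sum_congr rfl h1, Finset.sum_const,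
    ← Nat.cast_smul_eq_nsmul ℂ] at h2
  exact (smul_eq_zero.mp h2).resolve_left (by simpa using hS.ne_empty)

namespace IsCuspidalInducing

variable (D : IsCuspidalInducing H K₁ ρ)

open scoped Classical in
/-- The function in the compactly induced representation that is supported on `H` and has the
value `w` at `1`. -/
def bump : W →ₗ[ℂ] compactIndSpace H ρ where
  toFun w := ⟨fun x => if hx : x ∈ H then ρ ⟨x, hx⟩ w else 0, by
    refine ⟨fun h g => ?_, ⟨K₁, D.isOpen, fun g k hk => ?_⟩, {1}, isCompact_singleton,
      fun g hg => ?_⟩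
    · beta_reduce
      by_cases hg : g ∈ H
      · rw [dif_pos hg, dif_pos (H.mul_mem h.2 hg), ← Module.End.mul_apply, ← map_mul]
        rfl
      · rw [dif_neg hg, dif_neg fun h' => hg ((H.mul_mem_cancel_left h.2).mp h'), map_zero]
    · beta_reduce
      by_cases hg : g ∈ H
      · rw [dif_pos hg, dif_pos (H.mul_mem hg (D.le hk))]
        have : ρ ⟨g * k, H.mul_mem hg (D.le hk)⟩ = ρ ⟨g, hg⟩ * ρ ⟨k, D.le hk⟩ := by
          rw [← map_mul]; rfl
        rw [this, D.trivial_on ⟨k, D.le hk⟩ hk, mul_one]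
      · rw [dif_neg hg, dif_neg fun h' => hg ((H.mul_mem_cancel_right (D.le hk)).mp h')]
    · have : g ∈ H := by
        by_contra h
        exact hg (dif_neg h)
      exact ⟨g, this, 1, rfl, (mul_one g).symm⟩⟩
  map_add' w w' := by
    ext x
    by_cases hx : x ∈ H <;> simp [hx]
  map_smul' c w := by
    ext x
    by_cases hx : x ∈ H <;> simp [hx]

omit [IsTopologicalGroup G] in
lemma bump_of_mem (w : W) {x : G} (hx : x ∈ H) : (D.bump w).1 x = ρ ⟨x, hx⟩ w := dif_pos hx

omit [IsTopologicalGroup G] in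
lemma bump_of_notMem (w : W) {x : G} (hx : x ∉ H) : (D.bump w).1 x = 0 := dif_neg hx

omit [IsTopologicalGroup G] in
lemma bump_one (w : W) : (D.bump w).1 1 = w := by
  rw [D.bump_of_mem w H.one_mem]
  exact LinearMap.congr_fun (map_one ρ) w

lemma compactInd_bump (h : H) (w : W) : compactInd H ρ h (D.bump w) = D.bump (ρ h w) := by
  refine Subtype.ext (funext fun x => ?_)
  rw [compactInd_apply]
  by_cases hx : x ∈ H
  · rw [D.bump_of_mem _ hx, D.bump_of_mem _ (H.mul_mem hx h.2), ← Module.End.mul_apply, ← map_mul]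
    rfl
  · rw [D.bump_of_notMem _ hx,
      D.bump_of_notMem _ fun h' => hx ((H.mul_mem_cancel_right h.2).mp h')]

lemma compactInd_bump_of_mem {k : G} (hk : k ∈ K₁) (w : W) :
    compactInd H ρ k (D.bump w) = D.bump w := by
  rw [D.compactInd_bump ⟨k, D.le hk⟩, D.trivial_on ⟨k, D.le hk⟩ hk, Module.End.one_apply]

/-- Cuspidality kills `f` off `H`, and on `H` equivariance determines it from its value at `1`. -/
lemma eq_bump (f : compactIndSpace H ρ) (hf : ∀ k ∈ K₁, compactInd H ρ k f = f) :
    f = D.bump (f.1 1) := by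
  refine Subtype.ext (funext fun x => ?_)
  by_cases hx : x ∈ H
  · rw [D.bump_of_mem _ hx, ← compactIndSpace_left, mul_one]
  · rw [D.bump_of_notMem _ hx]
    obtain ⟨S, hS, hSK, h0⟩ := D.exists_sum_eq_zero x hx
    refine eq_zero_of_sum_eq_zero f (fun u hu => ?_) hS hSK h0
    exact congrFun (congrArg Subtype.val (hf u hu)) x

/-- Induction on the cosets `Hc` meeting the support: subtracting a translated bump with value
`f(c)` at `c` clears one coset. -/
lemma mem_span_of_support (s : Finset G) : ∀ f : compactIndSpace H ρ,
    (∀ x, f.1 x ≠ 0 → ∃ c ∈ s, x * c⁻¹ ∈ H) →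
    f ∈ Submodule.span ℂ (Set.range fun p : G × W => compactInd H ρ p.1 (D.bump p.2)) := by
  classical
  induction s using Finset.induction_on with
  | empty =>
    intro f hf
    have : f = 0 := Subtype.ext (funext fun x => by
      by_contra h
      simpa using hf x h)
    rw [this]
    exact zero_mem _
  | insert c s hc ih =>
    intro f hf
    have hb : compactInd H ρ c⁻¹ (D.bump (f.1 c)) ∈
        Submodule.span ℂ (Set.range fun p : G × W => compactInd H ρ p.1 (D.bump p.2)) :=
      Submodule.subset_span ⟨(c⁻¹, f.1 c), rfl⟩
    have hsub : f - compactInd H ρ c⁻¹ (D.bump (f.1 c)) ∈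
        Submodule.span ℂ (Set.range fun p : G × W => compactInd H ρ p.1 (D.bump p.2)) := by
      refine ih _ fun x hx => ?_
      change f.1 x - (D.bump (f.1 c)).1 (x * c⁻¹) ≠ 0 at hx
      by_cases hxc : x * c⁻¹ ∈ H
      · rw [D.bump_of_mem _ hxc, ← compactIndSpace_left] at hx
        simp at hx
      · rw [D.bump_of_notMem _ hxc, sub_zero] at hx
        obtain ⟨d, hd, hxd⟩ := hf x hx
        rcases Finset.mem_insert.mp hd with rfl | hd
        · exact absurd hxd hxc
        · exact ⟨d, hd, hxd⟩
    simpa using add_mem hsub hb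

include D in
lemma isOpen_subgroup : IsOpen (H : Set G) := Subgroup.isOpen_mono D.le D.isOpen

lemma span_bump :
    Submodule.span ℂ (Set.range fun p : G × W => compactInd H ρ p.1 (D.bump p.2)) = ⊤ := by
  refine eq_top_iff.mpr fun f _ => ?_
  obtain ⟨C, hC, hf⟩ := f.2.2.2
  have hopen : ∀ c : G, IsOpen {x : G | x * c⁻¹ ∈ H} := fun c =>
    D.isOpen_subgroup.preimage (continuous_mul_const c⁻¹)
  obtain ⟨s, hs⟩ := hC.elim_finite_subcover _ hopen fun c _ =>
    Set.mem_iUnion.mpr ⟨c, by simp [H.one_mem]⟩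
  refine D.mem_span_of_support s f fun x hx => ?_
  obtain ⟨h, hh, c, hc, rfl⟩ := hf x hx
  obtain ⟨d, hd⟩ := Set.mem_iUnion.mp (hs hc)
  obtain ⟨hds, hcd⟩ := Set.mem_iUnion.mp hd
  exact ⟨d, hds, by rw [mul_assoc]; exact H.mul_mem hh hcd⟩

include D in
lemma induction_on {P : compactIndSpace H ρ → Prop} (f : compactIndSpace H ρ)
    (hb : ∀ a w, P (compactInd H ρ a (D.bump w)))
    (h0 : P 0) (hadd : ∀ f f', P f → P f' → P (f + f')) (hsmul : ∀ (c : ℂ) f, P f → P (c • f)) :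
    P f := by
  have hf : f ∈ Submodule.span ℂ
      (Set.range fun p : G × W => compactInd H ρ p.1 (D.bump p.2)) := by
    rw [D.span_bump]; trivial
  exact Submodule.span_induction (by rintro _ ⟨p, rfl⟩; exact hb _ _) h0
    (fun x y _ _ => hadd x y) (fun c x _ => hsmul c x) hf

include D in
theorem irreducible_compactInd : (compactInd H ρ).IsIrreducible := by
  have hnt : ∃ w : W, w ≠ 0 := by
    by_contra! h
    obtain ⟨S, T, hST⟩ := D.irreducible.exists_pair_ne
    have : Subsingleton W := ⟨fun a b => by rw [h a, h b]⟩
    exact hST (Subrepresentation.toSubmodule_injective (Subsingleton.elim _ _))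
  refine { exists_pair_ne := ⟨⊥, ⊤, fun h => ?_⟩, eq_bot_or_eq_top := fun Y => ?_ }
  · obtain ⟨w, hw⟩ := hnt
    have : D.bump w ∈ (⊤ : Subrepresentation (compactInd H ρ)).toSubmodule :=
      Submodule.mem_top (x := D.bump w)
    rw [← h] at this
    have h0 : D.bump w = 0 := (Submodule.mem_bot ℂ).mp this
    apply hw
    rw [← D.bump_one w, h0]
    rfl
  · by_cases hY : ∀ f ∈ Y.toSubmodule, f = 0
    · left
      refine Subrepresentation.toSubmodule_injective (eq_bot_iff.mpr fun f hf => ?_)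
      exact (Submodule.mem_bot ℂ).mpr (hY f hf)
    · right
      push Not at hY
      obtain ⟨f, hf, hf0⟩ := hY
      obtain ⟨x, hx⟩ : ∃ x, f.1 x ≠ 0 := by
        by_contra! h
        exact hf0 (Subtype.ext (funext h))
      -- Once translated to be nonzero at `1`, `f` can be averaged over `K₁` without losing this:
      -- `ρ` is trivial on `K₁`, so the value is only multiplied by `T.card`. The average is a bump
      -- in `Y`, and irreducibility of `ρ` then yields all bumps.
      obtain ⟨T, hT, hTK, hfix⟩ := exists_finset_sum_fixed (compactInd H ρ) D.isCompact
        (compactInd_smooth (compactInd H ρ x f))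
      set f' := ∑ t ∈ T, compactInd H ρ t (compactInd H ρ x f) with hf'
      have hf'Y : f' ∈ Y.toSubmodule := sum_mem fun t _ =>
        Y.apply_mem_toSubmodule _ (Y.apply_mem_toSubmodule _ hf)
      have hval : f'.1 1 = (T.card : ℂ) • f.1 x := by
        have : f'.1 1 = ∑ t ∈ T, f.1 (t * x) := by
          rw [hf', AddSubmonoidClass.coe_finsetSum, Finset.sum_apply]
          exact Finset.sum_congr rfl fun t _ => by simp [compactInd_apply]
        rw [this, Finset.sum_congr rfl fun t ht => ?_, Finset.sum_const, Nat.cast_smul_eq_nsmul]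
        have := compactIndSpace_left f ⟨t, D.le (hTK t ht)⟩ x
        rwa [D.trivial_on ⟨t, D.le (hTK t ht)⟩ (hTK t ht)] at this
      have hw0 : f'.1 1 ≠ 0 := by
        rw [hval]
        exact smul_ne_zero (by simpa using hT.ne_empty) hx
      have hbump : ∀ w, D.bump w ∈ Y.toSubmodule := by
        intro w
        have hw : w ∈ Submodule.span ℂ (Set.range fun h => ρ h (f'.1 1)) := by
          rw [span_orbit_eq_top D.irreducible hw0]; trivial
        have hle : Submodule.span ℂ (Set.range fun h => ρ h (f'.1 1)) ≤
            Y.toSubmodule.comap D.bump := by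
          rw [Submodule.span_le]
          rintro _ ⟨h, rfl⟩
          change D.bump _ ∈ Y.toSubmodule
          rw [← D.compactInd_bump, ← D.eq_bump f' hfix]
          exact Y.apply_mem_toSubmodule _ hf'Y
        exact hle hw
      refine Subrepresentation.toSubmodule_injective (eq_top_iff.mpr ?_)
      rw [← D.span_bump, Submodule.span_le]
      rintro _ ⟨⟨a, w⟩, rfl⟩
      exact Y.apply_mem_toSubmodule _ (hbump w)

/-! ### Matrix coefficients -/

/-- A linear form on the compactly induced representation, as a function on `G` with values in the
dual of the inducing representation. -/
def coeff (l : Module.Dual ℂ (compactIndSpace H ρ)) (g : G) : W →ₗ[ℂ] ℂ :=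
  l ∘ₗ compactInd H ρ g⁻¹ ∘ₗ D.bump

lemma coeff_apply (l : Module.Dual ℂ (compactIndSpace H ρ)) (g : G) (w : W) :
    D.coeff l g w = l (compactInd H ρ g⁻¹ (D.bump w)) := rfl

lemma coeff_mul_left (l : Module.Dual ℂ (compactIndSpace H ρ)) (h : H) (g : G) (w : W) :
    D.coeff l (h * g) (ρ h w) = D.coeff l g w := by
  rw [coeff_apply, coeff_apply, ← D.compactInd_bump, ← Module.End.mul_apply, ← map_mul]
  congr 3
  group

lemma coeff_mul_right (l : Module.Dual ℂ (compactIndSpace H ρ)) (g u : G) :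
    D.coeff l (g * u) = D.coeff ((compactInd H ρ).dual u l) g := by
  ext w
  rw [coeff_apply, coeff_apply, _root_.mul_inv_rev, map_mul]
  rfl

/-- The dual counterpart of `eq_zero_of_sum_eq_zero`. It makes smooth linear forms compactly
supported modulo `H`. -/
lemma coeff_eq_zero (l : Module.Dual ℂ (compactIndSpace H ρ)) {U : Subgroup G} {g : G}
    (hl : ∀ u ∈ U, (compactInd H ρ).dual u l = l) {S : Finset H} (hS : S.Nonempty)
    (hSU : ∀ h ∈ S, g⁻¹ * h * g ∈ U) (h0 : ∑ h ∈ S, ρ h = 0) : D.coeff l g = 0 := by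
  ext w
  have h1 : ∀ h ∈ S, D.coeff l g (ρ h w) = D.coeff l g w := fun h hh => by
    rw [← D.coeff_mul_left l h g w, show (h : G) * g = g * (g⁻¹ * h * g) by group,
      D.coeff_mul_right, hl _ (hSU h hh)]
  have h2 := congrArg (D.coeff l g) (LinearMap.congr_fun h0 w)
  rw [LinearMap.sum_apply, map_sum, Finset.sum_congr rfl h1, Finset.sum_const, nsmul_eq_mul,
    LinearMap.zero_apply, map_zero] at h2
  exact (mul_eq_zero.mp h2).resolve_left (by simpa using hS.ne_empty)

lemma exists_compact_coeff {l : Module.Dual ℂ (compactIndSpace H ρ)}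
    (hl : l ∈ smoothDual (compactInd H ρ)) :
    ∃ C : Set G, IsCompact C ∧ ∀ g, D.coeff l g ≠ 0 → ∃ h ∈ H, ∃ c ∈ C, g = h * c := by
  obtain ⟨U, hU, hfix⟩ := hl
  obtain ⟨C, hC, h⟩ := D.exists_compact U hU
  refine ⟨C, hC, fun g hg => (h g).resolve_right ?_⟩
  rintro ⟨S, hS, hSU, h0⟩
  exact hg (D.coeff_eq_zero l hfix hS hSU h0)

/-- A bump translated by `a ∉ H` vanishes at `1`, and `l` kills it by cuspidality at `a⁻¹`. Thus
`l'(g v')` becomes a linear function of `v'(g)` in the orthogonality integral. -/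
lemma apply_eq_of_fixed {l : Module.Dual ℂ (compactIndSpace H ρ)}
    (hl : ∀ k ∈ K₁, (compactInd H ρ).dual k l = l) (f : compactIndSpace H ρ) :
    l f = D.coeff l 1 (f.1 1) := by
  refine D.induction_on (P := fun f => l f = D.coeff l 1 (f.1 1)) f (fun a w => ?_) ?_ (fun f f' h h' => ?_) (fun c f h => ?_)
  · have h1 : l (compactInd H ρ a (D.bump w)) = D.coeff l a⁻¹ w := by rw [coeff_apply, inv_inv]
    rw [h1, compactInd_apply, one_mul]
    by_cases ha : a ∈ H
    · rw [D.bump_of_mem w ha, ← D.coeff_mul_left l ⟨a, ha⟩ a⁻¹ w]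
      simp
    · rw [D.bump_of_notMem w ha, map_zero]
      obtain ⟨S, hS, hSK, h0⟩ := D.exists_sum_eq_zero a⁻¹ (by simpa using ha)
      rw [D.coeff_eq_zero l hl hS hSK h0, LinearMap.zero_apply]
  · rw [map_zero, ZeroMemClass.coe_zero, Pi.zero_apply, map_zero]
  · rw [map_add, h, h', ← map_add]; rfl
  · rw [map_smul, h, ← map_smul]; rfl

include D in
lemma exists_central (z : G) (hz : z ∈ Subgroup.center G) :
    ∃ c : ℂ, ‖c‖ = 1 ∧ ∀ f, compactInd H ρ z f = c • f := by
  obtain ⟨c, hc, h⟩ := D.central ⟨z, D.center_le hz⟩ hz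
  refine ⟨c, hc, fun f => Subtype.ext (funext fun x => ?_)⟩
  rw [compactInd_apply, ← Subgroup.mem_center_iff.mp hz x |>.symm]
  have := compactIndSpace_left f ⟨z, D.center_le hz⟩ x
  rw [h] at this
  exact this

include D in
lemma isCompact_image_mul {C : Set G} (hC : IsCompact C) :
    IsCompact ((fun g : G => (g : G ⧸ Subgroup.center G)) ''
      {g | ∃ h ∈ H, ∃ c ∈ C, g = h * c}) := by
  convert D.compact_mod.mul (hC.image (f := fun g : G => (g : G ⧸ Subgroup.center G))
    continuous_quot_mk) using 1
  ext x
  constructor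
  · rintro ⟨_, ⟨h, hh, c, hc, rfl⟩, rfl⟩
    exact ⟨_, ⟨h, hh, rfl⟩, _, ⟨c, hc, rfl⟩, rfl⟩
  · rintro ⟨_, ⟨h, hh, rfl⟩, _, ⟨c, hc, rfl⟩, rfl⟩
    exact ⟨_, ⟨h, hh, c, hc, rfl⟩, rfl⟩

-- On a translated bump, `l(g a · bump w)` is `D.coeff l (g a)⁻¹ w`, whose support is controlled by
-- `exists_compact_coeff`.
include D in
lemma exists_compact_matrixCoeff {l : Module.Dual ℂ (compactIndSpace H ρ)}
    (hl : l ∈ smoothDual (compactInd H ρ)) (v : compactIndSpace H ρ) :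
    ∃ S : Set (G ⧸ Subgroup.center G), IsCompact S ∧
      ∀ g : G, l (compactInd H ρ g v) ≠ 0 → (g : G ⧸ Subgroup.center G) ∈ S := by
  refine D.induction_on (P := fun v => ∃ S : Set (G ⧸ Subgroup.center G), IsCompact S ∧
    ∀ g : G, l (compactInd H ρ g v) ≠ 0 → (g : G ⧸ Subgroup.center G) ∈ S) v
    (fun a w => ?_) ?_ ?_ ?_
  · obtain ⟨C, hC, h⟩ := D.exists_compact_coeff hl
    refine ⟨((fun x => x⁻¹ * (a⁻¹ : G)) '' ((fun g : G => (g : G ⧸ Subgroup.center G)) ''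
      {g | ∃ h ∈ H, ∃ c ∈ C, g = h * c})), (D.isCompact_image_mul hC).image (by fun_prop),
      fun g hg => ?_⟩
    rw [← Module.End.mul_apply, ← map_mul] at hg
    have hne : D.coeff l (g * a)⁻¹ ≠ 0 := fun h0 => hg (by
      rw [← inv_inv (g * a), ← D.coeff_apply, h0, LinearMap.zero_apply])
    exact ⟨_, ⟨_, h _ hne, rfl⟩, by simp⟩
  · exact ⟨∅, isCompact_empty, fun g hg => by simp at hg⟩
  · rintro f f' ⟨S, hS, h⟩ ⟨S', hS', h'⟩
    refine ⟨S ∪ S', hS.union hS', fun g hg => ?_⟩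
    by_cases h0 : l (compactInd H ρ g f) = 0
    · exact Or.inr (h' g fun h0' => hg (by rw [map_add, map_add, h0, h0', add_zero]))
    · exact Or.inl (h g h0)
  · rintro c f ⟨S, hS, h⟩
    exact ⟨S, hS, fun g hg => h g fun h0 => hg (by rw [map_smul, map_smul, h0, smul_zero])⟩

end IsCuspidalInducing

end CompactInduction

/-! ### Integration over `G/Z` of functions on `G` invariant under the center. -/

section Descend

variable {G : Type*} [Group G] {E : Type*}

/-- A function on `G`, evaluated at representatives of the elements of `G / Z`. -/
def descend (F : G → E) (x : G ⧸ Subgroup.center G) : E := F x.out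

/-- Invariance of a function on `G` under translation by the center. -/
def CenterInvariant (F : G → E) : Prop := ∀ g, ∀ z ∈ Subgroup.center G, F (g * z) = F g

lemma CenterInvariant.descend_mk {F : G → E} (hF : CenterInvariant F) (g : G) :
    descend F (g : G ⧸ Subgroup.center G) = F g := by
  have h : g⁻¹ * (g : G ⧸ Subgroup.center G).out ∈ Subgroup.center G :=
    QuotientGroup.eq.mp (QuotientGroup.out_eq' _).symm
  rw [descend, ← hF g _ h, mul_inv_cancel_left]

lemma CenterInvariant.descend_mul_left {F : G → E} (hF : CenterInvariant F) (a : G) :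
    descend (fun g => F (a * g)) = fun x => descend F ((a : G ⧸ Subgroup.center G) * x) := by
  have hF' : CenterInvariant fun g => F (a * g) := fun g z hz => by
    beta_reduce
    rw [← mul_assoc, hF _ z hz]
  ext x
  obtain ⟨g, rfl⟩ := QuotientGroup.mk_surjective x
  rw [hF'.descend_mk, ← QuotientGroup.mk_mul, hF.descend_mk]

variable [TopologicalSpace G] [IsTopologicalGroup G]
  [MeasurableSpace (G ⧸ Subgroup.center G)] [BorelSpace (G ⧸ Subgroup.center G)]
  {μ : Measure (G ⧸ Subgroup.center G)}

/-- Right invariance under an open subgroup makes `F` locally constant, so its descent is continuous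
with compact support. -/
lemma integrable_descend [NormedAddCommGroup E] [IsFiniteMeasureOnCompacts μ] {F : G → E}
    (hF : CenterInvariant F)
    (hU : ∃ U : Subgroup G, IsOpen (U : Set G) ∧ ∀ g, ∀ u ∈ U, F (g * u) = F g)
    (hS : ∃ S : Set (G ⧸ Subgroup.center G), IsCompact S ∧
      ∀ g : G, F g ≠ 0 → (g : G ⧸ Subgroup.center G) ∈ S) :
    Integrable (descend F) μ := by
  obtain ⟨U, hU, hFU⟩ := hU
  obtain ⟨S, hS, hFS⟩ := hS
  have hcF : Continuous F := by
    refine IsLocallyConstant.continuous ((IsLocallyConstant.iff_exists_open F).mpr fun g =>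
      ⟨(fun x => g⁻¹ * x) ⁻¹' U, hU.preimage (continuous_const_mul _), ?_, fun x hx => ?_⟩)
    · simp [U.one_mem]
    · rw [← hFU g _ hx, mul_inv_cancel_left]
  have hc : Continuous (descend F : G ⧸ Subgroup.center G → E) := by
    refine (QuotientGroup.isQuotientMap_mk (N := Subgroup.center G)).continuous_iff.mpr ?_
    convert hcF using 1
    ext g
    exact hF.descend_mk g
  refine hc.integrable_of_hasCompactSupport (HasCompactSupport.intro hS fun x hx => ?_)
  obtain ⟨g, rfl⟩ := QuotientGroup.mk_surjective x
  rw [hF.descend_mk]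
  by_contra h
  exact hx (hFS g h)

lemma integral_descend_mul_left [NormedAddCommGroup E] [NormedSpace ℝ E] [μ.IsHaarMeasure]
    {F : G → E} (hF : CenterInvariant F) (a : G) :
    ∫ x, descend (fun g => F (a * g)) x ∂μ = ∫ x, descend F x ∂μ := by
  rw [hF.descend_mul_left]
  exact integral_mul_left_eq_self (μ := μ) (descend F) (a : G ⧸ Subgroup.center G)

end Descend

/-! ### Square integrability and Schur orthogonality for the induced representation. -/

namespace IsCuspidalInducing

section Pairing

variable {G : Type*} [Group G] [TopologicalSpace G] [IsTopologicalGroup G]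
  {W : Type*} [AddCommGroup W] [Module ℂ W] {H K₁ : Subgroup G} {ρ : Representation ℂ H W}
  (D : IsCuspidalInducing H K₁ ρ)

local notation "cSp" => compactIndSpace H ρ
local notation "cInd" => compactInd H ρ

lemma dual_mem_smoothDual {V : Type*} [AddCommGroup V] [Module ℂ V] {π : Representation ℂ G V}
    {l : Module.Dual ℂ V} (hl : l ∈ smoothDual π) (a : G) : π.dual a l ∈ smoothDual π := by
  obtain ⟨U, hU, h⟩ := hl
  refine ⟨U.comap (MulAut.conj a⁻¹).toMonoidHom, hU.preimage (by
    change Continuous fun x => a⁻¹ * x * a⁻¹⁻¹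
    fun_prop), fun g hg => ?_⟩
  have := h _ (Subgroup.mem_comap.mp hg)
  rw [← Module.End.mul_apply, ← map_mul]
  conv_rhs => rw [← this, ← Module.End.mul_apply, ← map_mul]
  simp [mul_assoc]

/-- The integrand in the Schur orthogonality relations. -/
def schurFun (l : Module.Dual ℂ cSp) (v : cSp) (l' : Module.Dual ℂ cSp) (v' : cSp) (g : G) : ℂ :=
  l (cInd g⁻¹ v) * l' (cInd g v')

lemma apply_inv_mul_central {z : G} {c : ℂ} (hc : ‖c‖ = 1) (h : ∀ f, cInd z f = c • f)
    (l : Module.Dual ℂ cSp) (v : cSp) (g : G) : l (cInd (g * z)⁻¹ v) = c⁻¹ * l (cInd g⁻¹ v) := by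
  have hc0 : c ≠ 0 := fun h0 => by simp [h0] at hc
  have h' : cInd z⁻¹ (cInd g⁻¹ v) = c⁻¹ • cInd g⁻¹ v := by
    rw [eq_inv_smul_iff₀ hc0, ← h, ← Module.End.mul_apply, ← map_mul]
    simp
  rw [_root_.mul_inv_rev, map_mul, Module.End.mul_apply, h', map_smul, smul_eq_mul]

lemma apply_mul_central {z : G} {c : ℂ} (h : ∀ f, cInd z f = c • f)
    (l : Module.Dual ℂ cSp) (v : cSp) (g : G) : l (cInd (g * z) v) = c * l (cInd g v) := by
  rw [map_mul, Module.End.mul_apply, h, map_smul, map_smul, smul_eq_mul]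

lemma exists_isOpen_schurFun {l : Module.Dual ℂ cSp} (hl : l ∈ smoothDual cInd) (v : cSp)
    (l' : Module.Dual ℂ cSp) (v' : cSp) :
    ∃ U : Subgroup G, IsOpen (U : Set G) ∧
      ∀ g, ∀ u ∈ U, schurFun l v l' v' (g * u) = schurFun l v l' v' g := by
  obtain ⟨U, hU, h⟩ := hl
  obtain ⟨U', hU', h'⟩ := compactInd_smooth v'
  refine ⟨U ⊓ U', hU.inter hU', fun g u hu => ?_⟩
  rw [schurFun, schurFun, _root_.mul_inv_rev, map_mul, map_mul, Module.End.mul_apply,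
    Module.End.mul_apply, h' u hu.2]
  congr 1
  exact LinearMap.congr_fun (h u hu.1) _

include D

lemma centerInvariant_of_mul {E : Type*} {f : G → E} [AddCommGroup E] [Module ℂ E]
    {φ : G → ℂ} (z : ∀ z ∈ Subgroup.center G, ∀ c : ℂ, ‖c‖ = 1 → (∀ f, cInd z f = c • f) →
      ∀ g, φ (g * z) = c⁻¹ * φ g ∧ f (g * z) = c • f g) :
    CenterInvariant fun g => φ g • f g := by
  intro g z' hz
  obtain ⟨c, hc, h⟩ := D.exists_central z' hz
  have hc0 : c ≠ 0 := fun h0 => by simp [h0] at hc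
  obtain ⟨h1, h2⟩ := z z' hz c hc h g
  beta_reduce
  rw [h1, h2, smul_smul, mul_right_comm, inv_mul_cancel₀ hc0, one_mul]

lemma centerInvariant_schurFun (l : Module.Dual ℂ cSp) (v : cSp) (l' : Module.Dual ℂ cSp) (v' : cSp) :
    CenterInvariant (schurFun l v l' v') :=
  D.centerInvariant_of_mul fun _ _ _ hc h g =>
    ⟨apply_inv_mul_central hc h l v g, apply_mul_central h l' v' g⟩

variable [MeasurableSpace (G ⧸ Subgroup.center G)] [BorelSpace (G ⧸ Subgroup.center G)]
  {μ : Measure (G ⧸ Subgroup.center G)}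

lemma integrable_schurFun [IsFiniteMeasureOnCompacts μ] {l l' : Module.Dual ℂ cSp}
    (hl : l ∈ smoothDual cInd) (hl' : l' ∈ smoothDual cInd) (v v' : cSp) :
    Integrable (descend (schurFun l v l' v')) μ := by
  obtain ⟨S, hS, h⟩ := D.exists_compact_matrixCoeff hl' v'
  exact integrable_descend (D.centerInvariant_schurFun l v l' v') (exists_isOpen_schurFun hl v l' v')
    ⟨S, hS, fun g hg => h g (right_ne_zero_of_mul hg)⟩

theorem isDiscreteSeries [IsFiniteMeasureOnCompacts μ] : IsDiscreteSeries cInd μ where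
  smooth := compactInd_smooth
  irreducible := D.irreducible_compactInd
  squareIntegrable := fun l hl v => by
    have hF : CenterInvariant fun g => ‖l (cInd g v)‖ ^ 2 := fun g z hz => by
      obtain ⟨c, hc, h⟩ := D.exists_central z hz
      beta_reduce
      rw [apply_mul_central h, norm_mul, hc, one_mul]
    obtain ⟨S, hS, h⟩ := D.exists_compact_matrixCoeff hl v
    obtain ⟨U, hU, hv⟩ := compactInd_smooth v
    refine ⟨descend fun g => ‖l (cInd g v)‖ ^ 2, hF.descend_mk, integrable_descend hF
      ⟨U, hU, fun g u hu => ?_⟩ ⟨S, hS, fun g hg => h g fun h0 => hg (by simp [h0])⟩⟩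
    rw [map_mul, Module.End.mul_apply, hv u hu]

/-- Substitution `g ↦ ag`. It reduces orthogonality to untranslated bumps by moving `a` onto `l'`.
-/
lemma integral_schurFun_translate [μ.IsHaarMeasure] (l : Module.Dual ℂ cSp) (v : cSp)
    (l' : Module.Dual ℂ cSp) (v' : cSp) (a : G) :
    ∫ x, descend (schurFun l (cInd a v) l' v') x ∂μ =
      ∫ x, descend (schurFun l v ((cInd).dual a⁻¹ l') v') x ∂μ := by
  rw [← integral_descend_mul_left (D.centerInvariant_schurFun l (cInd a v) l' v') a]
  congr 1
  ext1 x
  simp only [descend, schurFun]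
  generalize x.out = g
  rw [← Module.End.mul_apply, ← map_mul, Representation.dual_apply,
    Module.Dual.transpose_apply, LinearMap.comp_apply, inv_inv, ← Module.End.mul_apply (cInd a),
    ← map_mul]
  congr 4
  group

end Pairing

section Schur

variable {G : Type*} [Group G] [TopologicalSpace G] [IsTopologicalGroup G]
  {n : ℕ} {H K₁ : Subgroup G} {ρ : Representation ℂ H (Fin n → ℂ)}
  (D : IsCuspidalInducing H K₁ ρ)

local notation "cSp" => compactIndSpace H ρ
local notation "cInd" => compactInd H ρ

include D in
lemma exists_compact_support (v : cSp) : ∃ S : Set (G ⧸ Subgroup.center G), IsCompact S ∧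
    ∀ g : G, v.1 g ≠ 0 → (g : G ⧸ Subgroup.center G) ∈ S := by
  obtain ⟨C, hC, h⟩ := v.2.2.2
  exact ⟨_, D.isCompact_image_mul hC, fun g hg => ⟨g, h g hg, rfl⟩⟩

lemma value_mul_central {z : G} {c : ℂ} (h : ∀ f, cInd z f = c • f)
    (v : cSp) (g : G) : v.1 (g * z) = c • v.1 g :=
  congrFun (congrArg Subtype.val (h v)) g

lemma centerInvariant_coeff_smul (l : Module.Dual ℂ cSp) (v : cSp) (w : Fin n → ℂ) :
    CenterInvariant fun g => D.coeff l g w • v.1 g :=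
  D.centerInvariant_of_mul fun _ _ _ hc h g =>
    ⟨apply_inv_mul_central hc h l _ g, value_mul_central h v g⟩

variable [MeasurableSpace (G ⧸ Subgroup.center G)] [BorelSpace (G ⧸ Subgroup.center G)]
  {μ : Measure (G ⧸ Subgroup.center G)} [μ.IsHaarMeasure]

lemma integrable_coeff_smul {l : Module.Dual ℂ cSp} (hl : l ∈ smoothDual cInd) (v : cSp)
    (w : Fin n → ℂ) : Integrable (descend fun g => D.coeff l g w • v.1 g) μ := by
  obtain ⟨S, hS, h⟩ := D.exists_compact_support v
  obtain ⟨U, hU, hl⟩ := hl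
  obtain ⟨U', hU', hv⟩ := compactInd_smooth v
  refine integrable_descend (D.centerInvariant_coeff_smul l v w)
    ⟨U ⊓ U', hU.inter hU', fun g u hu => ?_⟩ ⟨S, hS, fun g hg => h g (right_ne_zero_of_smul hg)⟩
  rw [D.coeff_mul_right, hl u hu.1]
  congr 1
  exact congrFun (congrArg Subtype.val (hv u hu.2)) g

/-- The operator `w ↦ ∫ ⟨λ(g), w⟩ v(g) dg` on the inducing representation, for `v` in the compactly
induced representation and `λ` the function attached to a smooth linear form. -/
def schurOp (μ : Measure (G ⧸ Subgroup.center G)) [μ.IsHaarMeasure] {l : Module.Dual ℂ cSp}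
    (hl : l ∈ smoothDual cInd) (v : cSp) : (Fin n → ℂ) →ₗ[ℂ] (Fin n → ℂ) where
  toFun w := ∫ x, descend (fun g => D.coeff l g w • v.1 g) x ∂μ
  map_add' w w' := by
    rw [← integral_add (D.integrable_coeff_smul hl v w) (D.integrable_coeff_smul hl v w')]
    congr 1
    ext1 x
    simp [descend, add_smul]
  map_smul' c w := by
    rw [RingHom.id_apply, ← integral_smul]
    congr 1
    ext1 x
    simp [descend, mul_smul]

lemma apply_schurOp {l : Module.Dual ℂ cSp} (hl : l ∈ smoothDual cInd) (v : cSp) {E : Type*}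
    [NormedAddCommGroup E] [NormedSpace ℂ E] [FiniteDimensional ℂ E] (A : (Fin n → ℂ) →ₗ[ℂ] E)
    (w : Fin n → ℂ) : A (D.schurOp μ hl v w) =
      ∫ x, descend (fun g => D.coeff l g w • A (v.1 g)) x ∂μ := by
  have := (LinearMap.toContinuousLinearMap A).integral_comp_comm
    (D.integrable_coeff_smul (μ := μ) hl v w)
  change A (∫ x, descend (fun g => D.coeff l g w • v.1 g) x ∂μ) = _
  rw [← LinearMap.coe_toContinuousLinearMap' A, ← this]
  congr 1
  ext1 x
  simp [descend]

/-- Substitution `g ↦ hg`, under which `λ(hg)(ρ(h)w) = λ(g)(w)` and `v(hg) = ρ(h)v(g)`. -/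
lemma schurOp_comm {l : Module.Dual ℂ cSp} (hl : l ∈ smoothDual cInd) (v : cSp) (h : H) :
    D.schurOp μ hl v ∘ₗ ρ h = ρ h ∘ₗ D.schurOp μ hl v := by
  refine LinearMap.ext fun w => ?_
  rw [LinearMap.comp_apply, LinearMap.comp_apply, D.apply_schurOp hl v (ρ h)]
  change ∫ x, descend (fun g => D.coeff l g (ρ h w) • v.1 g) x ∂μ = _
  rw [← integral_descend_mul_left (D.centerInvariant_coeff_smul l v (ρ h w)) (h : G)]
  simp only [D.coeff_mul_left, compactIndSpace_left]

lemma trace_schurOp_eq_integral {l : Module.Dual ℂ cSp} (hl : l ∈ smoothDual cInd) (v : cSp) :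
    Integrable (descend fun g => D.coeff l g (v.1 g)) μ ∧
      LinearMap.trace ℂ _ (D.schurOp μ hl v) =
        ∫ x, descend (fun g => D.coeff l g (v.1 g)) x ∂μ := by
  have hsum : (descend fun g => D.coeff l g (v.1 g)) = fun x => ∑ i : Fin n,
      descend (fun g => D.coeff l g (Pi.single i 1) • v.1 g i) x := by
    ext1 x
    simp only [descend]
    rw [LinearMap.pi_apply_eq_sum_univ (D.coeff l _)]
    refine Finset.sum_congr rfl fun i _ => ?_
    rw [smul_eq_mul, smul_eq_mul, mul_comm]
    congr 2
    ext j
    simp [Pi.single_apply, eq_comm]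
  have hint : ∀ i : Fin n,
      Integrable (descend fun g => D.coeff l g (Pi.single i 1) • v.1 g i) μ := fun i =>
    (ContinuousLinearMap.proj (R := ℂ) (φ := fun _ : Fin n => ℂ) i).integrable_comp
      (D.integrable_coeff_smul hl v (Pi.single i 1))
  rw [hsum]
  refine ⟨integrable_finsetSum _ fun i _ => hint i, ?_⟩
  rw [integral_finsetSum _ fun i _ => hint i,
    LinearMap.trace_eq_matrix_trace ℂ (Pi.basisFun ℂ (Fin n)), Matrix.trace]
  refine Finset.sum_congr rfl fun i _ => ?_
  rw [Matrix.diag_apply, LinearMap.toMatrix_apply, Pi.basisFun_repr, Pi.basisFun_apply]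
  exact D.apply_schurOp hl v (LinearMap.proj i) (Pi.single i 1)

/-- For `v = a · bump w` the integrand is the constant `l(v)` on the image of `Ha⁻¹` and zero
elsewhere. The hypothesis `hμ` identifies the volume of this right translate with that of `H/Z`. -/
lemma integral_coeff_value {l : Module.Dual ℂ cSp} (hl : l ∈ smoothDual cInd) (v : cSp)
    (hμ : ∀ a : G, μ ((fun g : G => (g : G ⧸ Subgroup.center G)) '' {g | g * a ∈ H}) =
      μ ((fun g : G => (g : G ⧸ Subgroup.center G)) '' (H : Set G))) :
    ∫ x, descend (fun g => D.coeff l g (v.1 g)) x ∂μ =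
      μ.real ((fun g : G => (g : G ⧸ Subgroup.center G)) '' (H : Set G)) * l v := by
  refine D.induction_on (P := fun v => ∫ x, descend (fun g => D.coeff l g (v.1 g)) x ∂μ =
      μ.real ((fun g : G => (g : G ⧸ Subgroup.center G)) '' (H : Set G)) * l v) v
    (fun a w => ?_) ?_ (fun f f' h h' => ?_) (fun c f h => ?_)
  · have hopen : IsOpen ((fun g : G => (g : G ⧸ Subgroup.center G)) '' {g | g * a ∈ H}) :=
      QuotientGroup.isOpenMap_coe _ (D.isOpen_subgroup.preimage (continuous_mul_const a))
    have hind : (descend fun g => D.coeff l g ((cInd a (D.bump w)).1 g)) =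
        ((fun g : G => (g : G ⧸ Subgroup.center G)) '' {g | g * a ∈ H}).indicator
          fun _ => l (cInd a (D.bump w)) := by
      ext1 x
      rw [descend, compactInd_apply]
      by_cases hx : x.out * a ∈ H
      · rw [Set.indicator_of_mem (show x ∈ (fun g : G => (g : G ⧸ Subgroup.center G)) ''
          {g | g * a ∈ H} from ⟨x.out, hx, QuotientGroup.out_eq' x⟩), D.bump_of_mem w hx]
        have := D.coeff_mul_left l ⟨x.out * a, hx⟩ a⁻¹ w
        rw [coeff_apply D l a⁻¹, inv_inv] at this
        rw [← this]
        simp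
      · rw [D.bump_of_notMem w hx, map_zero, Set.indicator_of_notMem]
        rintro ⟨g, hg, hgx⟩
        apply hx
        have hz : g⁻¹ * x.out ∈ Subgroup.center G :=
          QuotientGroup.eq.mp (hgx.trans x.out_eq.symm)
        have : x.out * a = g * a * (g⁻¹ * x.out) := by
          rw [mul_assoc, Subgroup.mem_center_iff.mp hz a]
          group
        rw [this]
        exact H.mul_mem hg (D.center_le hz)
    rw [hind, integral_indicator_const _ hopen.measurableSet, measureReal_def, hμ,
      ← measureReal_def]
    exact Complex.real_smul
  · simp [descend]
  · have hadd : (descend fun g => D.coeff l g ((f + f').1 g)) = fun x =>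
        descend (fun g => D.coeff l g (f.1 g)) x + descend (fun g => D.coeff l g (f'.1 g)) x := by
      ext1 x
      simp only [descend]
      rw [← map_add]
      rfl
    rw [hadd, integral_add (D.trace_schurOp_eq_integral hl f).1
      (D.trace_schurOp_eq_integral hl f').1, h, h', map_add, mul_add]
  · have hsmul : (descend fun g => D.coeff l g ((c • f).1 g)) = fun x =>
        c • descend (fun g => D.coeff l g (f.1 g)) x := by
      ext1 x
      simp only [descend]
      rw [← map_smul]
      rfl
    rw [hsmul, integral_smul, h, map_smul, smul_eq_mul, smul_eq_mul]
    ring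

/-- Schur's lemma makes the operator a scalar, and its trace, `n` times that scalar, is known from
`integral_coeff_value`. -/
lemma schurOp_eq_smul {l : Module.Dual ℂ cSp} (hl : l ∈ smoothDual cInd) (v : cSp)
    (hμ : ∀ a : G, μ ((fun g : G => (g : G ⧸ Subgroup.center G)) '' {g | g * a ∈ H}) =
      μ ((fun g : G => (g : G ⧸ Subgroup.center G)) '' (H : Set G))) :
    (n : ℂ) • D.schurOp μ hl v =
      (μ.real ((fun g : G => (g : G ⧸ Subgroup.center G)) '' (H : Set G)) * l v) •
        LinearMap.id := by
  have hnt : Nontrivial (Fin n → ℂ) := by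
    by_contra h
    rw [not_nontrivial_iff_subsingleton] at h
    obtain ⟨S, T, hST⟩ := D.irreducible.exists_pair_ne
    exact hST (Subrepresentation.toSubmodule_injective (Subsingleton.elim _ _))
  obtain ⟨c, hc⟩ := Module.End.exists_eigenvalue (D.schurOp μ hl v)
  obtain ⟨u, hu⟩ := hc.exists_hasEigenvector
  have hscalar : D.schurOp μ hl v = c • LinearMap.id := by
    refine LinearMap.ext_on (span_orbit_eq_top D.irreducible hu.2) ?_
    rintro _ ⟨h, rfl⟩
    have := LinearMap.congr_fun (D.schurOp_comm (μ := μ) hl v h) u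
    rw [LinearMap.comp_apply, LinearMap.comp_apply, hu.apply_eq_smul, map_smul] at this
    exact this
  have htr := (D.trace_schurOp_eq_integral (μ := μ) hl v).2
  rw [D.integral_coeff_value hl v hμ, hscalar, map_smul, LinearMap.trace_id,
    Module.finrank_fin_fun, smul_eq_mul] at htr
  rw [← htr, hscalar, smul_smul, mul_comm]

include D

/-- Schur orthogonality for the compactly induced representation. -/
theorem integral_schurFun {l l' : Module.Dual ℂ cSp} (hl : l ∈ smoothDual cInd)
    (hl' : l' ∈ smoothDual cInd) (v v' : cSp)
    (hμ : ∀ a : G, μ ((fun g : G => (g : G ⧸ Subgroup.center G)) '' {g | g * a ∈ H}) =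
      μ ((fun g : G => (g : G ⧸ Subgroup.center G)) '' (H : Set G))) :
    n * ∫ x, descend (schurFun l v l' v') x ∂μ =
      μ.real ((fun g : G => (g : G ⧸ Subgroup.center G)) '' (H : Set G)) * (l v' * l' v) := by
  refine D.induction_on (P := fun v => n * ∫ x, descend (schurFun l v l' v') x ∂μ =
      μ.real ((fun g : G => (g : G ⧸ Subgroup.center G)) '' (H : Set G)) * (l v' * l' v)) v
    (fun a w => ?_) ?_ (fun f f' h h' => ?_) (fun c f h => ?_)
  · rw [D.integral_schurFun_translate]
    have hval : l' (cInd a (D.bump w)) = (cInd).dual a⁻¹ l' (D.bump w) := by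
      rw [Representation.dual_apply, Module.Dual.transpose_apply, LinearMap.comp_apply, inv_inv]
    rw [hval]
    have hl'a := dual_mem_smoothDual hl' a⁻¹
    generalize (cInd).dual a⁻¹ l' = m at hl'a
    -- The bump is fixed by `K₁`, so averaging `m` over `K₁` multiplies both sides by `T.card`. The
    -- averaged form sees only values at `1`, and the integral becomes a value of `schurOp`.
    obtain ⟨T, hT, hTK, hfix⟩ := exists_finset_sum_fixed (cInd).dual D.isCompact hl'a
    set m' := ∑ t ∈ T, (cInd).dual t m with hm'
    have hT0 : (T.card : ℂ) ≠ 0 := by simpa using hT.ne_empty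
    have hm'v : m' (D.bump w) = T.card * m (D.bump w) := by
      rw [hm', LinearMap.sum_apply, Finset.sum_congr rfl fun t ht => ?_, Finset.sum_const,
        nsmul_eq_mul]
      rw [Representation.dual_apply, Module.Dual.transpose_apply, LinearMap.comp_apply,
        D.compactInd_bump_of_mem (K₁.inv_mem (hTK t ht))]
    have hint : ∫ x, descend (schurFun l (D.bump w) m' v') x ∂μ =
        T.card * ∫ x, descend (schurFun l (D.bump w) m v') x ∂μ := by
      have : (descend (schurFun l (D.bump w) m' v') : G ⧸ Subgroup.center G → ℂ) =
          fun x => ∑ t ∈ T, descend (schurFun l (D.bump w) ((cInd).dual t m) v') x := by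
        ext1 x
        simp only [descend, schurFun]
        rw [hm', LinearMap.sum_apply, Finset.mul_sum]
      rw [this, integral_finsetSum _ fun t _ => D.integrable_schurFun hl
        (dual_mem_smoothDual hl'a t) _ _, Finset.sum_congr rfl fun t ht => ?_, Finset.sum_const,
        nsmul_eq_mul]
      rw [← inv_inv t, ← D.integral_schurFun_translate,
        D.compactInd_bump_of_mem (K₁.inv_mem (hTK t ht))]
    have hop : ∫ x, descend (schurFun l (D.bump w) m' v') x ∂μ =
        D.coeff m' 1 (D.schurOp μ hl v' w) := by
      rw [D.apply_schurOp hl v' (D.coeff m' 1) w]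
      congr 1
      ext1 x
      simp only [descend, schurFun]
      rw [D.apply_eq_of_fixed hfix, compactInd_apply, one_mul]
      rfl
    have hs := LinearMap.congr_fun (D.schurOp_eq_smul (μ := μ) hl v' hμ) w
    have hs' := congrArg (D.coeff m' 1) hs
    rw [LinearMap.smul_apply, LinearMap.smul_apply, map_smul, map_smul, ← hop, hint,
      LinearMap.id_apply, coeff_apply, inv_one, map_one, Module.End.one_apply, hm'v,
      smul_eq_mul, smul_eq_mul] at hs'
    refine mul_left_cancel₀ hT0 ?_
    linear_combination hs'
  · simp [descend, schurFun]
  · have hadd : (descend (schurFun l (f + f') l' v') : G ⧸ Subgroup.center G → ℂ) = fun x =>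
        descend (schurFun l f l' v') x + descend (schurFun l f' l' v') x := by
      ext1 x
      simp only [descend, schurFun]
      rw [map_add, map_add, add_mul]
    rw [hadd, integral_add (D.integrable_schurFun hl hl' _ _) (D.integrable_schurFun hl hl' _ _),
      mul_add, h, h', map_add]
    ring
  · have hsmul : (descend (schurFun l (c • f) l' v') : G ⧸ Subgroup.center G → ℂ) = fun x =>
        c • descend (schurFun l f l' v') x := by
      ext1 x
      simp only [descend, schurFun]
      rw [map_smul, map_smul, smul_mul_assoc]
    rw [hsmul, integral_smul, map_smul, smul_eq_mul, smul_eq_mul, mul_left_comm, h]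
    ring

/-- The formal dimension of a compactly induced cuspidal representation. -/
theorem hasFormalDimension {d : ℝ} (hd : 0 < d)
    (hμ : ∀ a : G, μ ((fun g : G => (g : G ⧸ Subgroup.center G)) '' {g | g * a ∈ H}) =
      μ ((fun g : G => (g : G ⧸ Subgroup.center G)) '' (H : Set G)))
    (hn : (n : ℝ) = d * μ.real ((fun g : G => (g : G ⧸ Subgroup.center G)) '' (H : Set G)))
    (hn0 : n ≠ 0) : HasFormalDimension cInd μ d where
  discreteSeries := D.isDiscreteSeries
  pos := hd
  schur := fun l hl l' hl' v v' => by
    refine ⟨descend (schurFun l v l' v'), fun g => ?_, D.integrable_schurFun hl hl' v v', ?_⟩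
    · rw [(D.centerInvariant_schurFun l v l' v').descend_mk, schurFun,
        Representation.dual_apply, Module.Dual.transpose_apply, LinearMap.comp_apply]
    · have h := D.integral_schurFun hl hl' v v' hμ
      have hn' : (n : ℂ) =
          d * μ.real ((fun g : G => (g : G ⧸ Subgroup.center G)) '' (H : Set G)) := by
        exact_mod_cast hn
      have hn0' : (n : ℂ) ≠ 0 := by exact_mod_cast hn0
      have hd' : (d : ℂ) ≠ 0 := by exact_mod_cast hd.ne'
      refine mul_left_cancel₀ hn0' ?_
      rw [h, hn']
      field_simp

end Schur

end IsCuspidalInducing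

/-! ### Transport along isomorphisms of representations. -/

section Transport

variable {G : Type*} [Group G] [TopologicalSpace G] {V V' : Type*} [AddCommGroup V] [Module ℂ V]
  [AddCommGroup V'] [Module ℂ V'] {π : Representation ℂ G V} {π' : Representation ℂ G V'}

lemma comp_symm_mem_smoothDual {e : V ≃ₗ[ℂ] V'} (he : ∀ g v, e (π g v) = π' g (e v))
    {l : Module.Dual ℂ V} (hl : l ∈ smoothDual π) : l ∘ₗ e.symm.toLinearMap ∈ smoothDual π' := by
  obtain ⟨U, hU, h⟩ := hl
  refine ⟨U, hU, fun g hg => LinearMap.ext fun v => ?_⟩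
  have h1 := LinearMap.congr_fun (h g hg) (e.symm v)
  rw [Representation.dual_apply, Module.Dual.transpose_apply, LinearMap.comp_apply] at h1 ⊢
  have h2 : e.symm (π' g⁻¹ v) = π g⁻¹ (e.symm v) := by
    rw [e.symm_apply_eq, he, e.apply_symm_apply]
  rw [LinearMap.comp_apply, LinearMap.comp_apply]
  change l (e.symm (π' g⁻¹ v)) = l (e.symm v)
  rw [h2, h1]

/-- Isomorphic representations have the same subrepresentations. -/
def subrepresentationOrderIso {e : V ≃ₗ[ℂ] V'} (he : ∀ g v, e (π g v) = π' g (e v)) :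
    Subrepresentation π ≃o Subrepresentation π' where
  toFun Y := ⟨Y.toSubmodule.map e.toLinearMap, by
    rintro g _ ⟨v, hv, rfl⟩
    exact ⟨π g v, Y.apply_mem_toSubmodule g hv, he g v⟩⟩
  invFun Y := ⟨Y.toSubmodule.comap e.toLinearMap, fun g v hv => by
    change e (π g v) ∈ Y.toSubmodule
    rw [he]
    exact Y.apply_mem_toSubmodule g hv⟩
  left_inv Y := Subrepresentation.toSubmodule_injective
    (Submodule.comap_map_eq_of_injective e.injective _)
  right_inv Y := Subrepresentation.toSubmodule_injective
    (Submodule.map_comap_eq_of_surjective e.surjective _)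
  map_rel_iff' := Submodule.map_le_map_iff_of_injective e.injective _ _

/-- The formal dimension only depends on the isomorphism class of a representation. -/
lemma HasFormalDimension.of_linearEquiv [MeasurableSpace (G ⧸ Subgroup.center G)]
    {μ : Measure (G ⧸ Subgroup.center G)} {d : ℝ} {e : V ≃ₗ[ℂ] V'}
    (he : ∀ g v, e (π g v) = π' g (e v)) (h : HasFormalDimension π' μ d) :
    HasFormalDimension π μ d := by
  have hl' : ∀ (l : Module.Dual ℂ V) (v : V), (l ∘ₗ e.symm.toLinearMap) (e v) = l v :=
    fun l v => congrArg l (e.symm_apply_apply v)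
  refine ⟨⟨fun v => ?_, ?_, fun l hl v => ?_⟩, h.pos, fun l hl l' hl'' v v' => ?_⟩
  · obtain ⟨U, hU, hv⟩ := h.discreteSeries.smooth (e v)
    exact ⟨U, hU, fun g hg => e.injective ((he g v).trans (hv g hg))⟩
  · exact (subrepresentationOrderIso he).isSimpleOrder_iff.mpr h.discreteSeries.irreducible
  · obtain ⟨φ, hφ, hint⟩ := h.discreteSeries.squareIntegrable _
      (comp_symm_mem_smoothDual he hl) (e v)
    exact ⟨φ, fun g => by rw [hφ, ← he, hl'], hint⟩
  · obtain ⟨φ, hφ, hint⟩ := h.schur _ (comp_symm_mem_smoothDual he hl) _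
      (comp_symm_mem_smoothDual he hl'') (e v) (e v')
    simp only [hl'] at hint
    refine ⟨φ, fun g => ?_, hint⟩
    rw [hφ, ← he, hl', Representation.dual_apply, Representation.dual_apply,
      Module.Dual.transpose_apply, Module.Dual.transpose_apply, LinearMap.comp_apply, ← he, hl',
      LinearMap.comp_apply]

end Transport

/-! ### The modular character on compact open subgroups. -/

section Modular

open MeasureTheory.Measure

/-- The modular character is trivial on compact open subgroups. -/
lemma modularCharacter_eq_one_of_mem {Γ : Type*} [Group Γ] [TopologicalSpace Γ]
    [IsTopologicalGroup Γ] [LocallyCompactSpace Γ] [MeasurableSpace Γ] [BorelSpace Γ]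
    (μ : Measure Γ) [μ.IsHaarMeasure] {A : Subgroup Γ} (hA : IsOpen (A : Set Γ))
    (hA' : IsCompact (A : Set Γ)) :
    (∀ a : Γ, μ ((· * a) ⁻¹' A) = modularCharacter a • μ A) ∧ ∀ a ∈ A, modularCharacter a = 1 := by
  have h1 : ∀ a : Γ, μ ((· * a) ⁻¹' A) = modularCharacter a • μ A := fun a => by
    -- The push-forward under right translation is again left invariant, hence proportional to `μ`.
    -- For `a ∈ A` the translate of `A` is `A`, whose measure is finite and nonzero, so the factor
    -- is `1`.
    have h := measure_isMulInvariant_eq_smul_of_isCompact_closure (map (· * a) μ) μ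
      (s := (A : Set Γ)) (by rwa [(A.isClosed_of_isOpen hA).closure_eq])
    rw [map_apply (measurable_mul_const a) hA.measurableSet] at h
    rw [h, ← modularCharacterFun_eq_haarScalarFactor]
    rfl
  refine ⟨h1, fun a ha => ?_⟩
  have h2 : (· * a) ⁻¹' (A : Set Γ) = A := by
    ext x
    exact A.mul_mem_cancel_right ha
  have h3 := h1 a
  rw [h2, ENNReal.smul_def, smul_eq_mul] at h3
  have hpos : μ A ≠ 0 := (hA.measure_pos μ ⟨1, A.one_mem⟩).ne'
  have htop : μ A ≠ ⊤ := hA'.measure_lt_top.ne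
  have h4 : (modularCharacter a : ENNReal) = 1 :=
    (ENNReal.mul_left_inj hpos htop).mp (h3.symm.trans (one_mul _).symm)
  exact_mod_cast h4

end Modular

/-! ### Cartan decomposition of `GL(2, F)` and vanishing sums of operators. -/

section LocalField

variable {F : Type*} [Field F]

/-- The matrix `diag(1, δ)`. -/
def diagOne (δ : Fˣ) : GL (Fin 2) F :=
  ⟨!![1, 0; 0, (δ : F)], !![1, 0; 0, (δ⁻¹ : Fˣ)], by simp [one_fin_two], by simp [one_fin_two]⟩

lemma diagOne_val (δ : Fˣ) : (diagOne δ : Matrix (Fin 2) (Fin 2) F) = !![1, 0; 0, (δ : F)] := rfl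

/-- The permutation matrix of order two. -/
def weyl (R : Type*) [CommRing R] : GL (Fin 2) R :=
  ⟨!![0, 1; 1, 0], !![0, 1; 1, 0], by simp [one_fin_two], by simp [one_fin_two]⟩

lemma weyl_val (R : Type*) [CommRing R] :
    (weyl R : Matrix (Fin 2) (Fin 2) R) = !![0, 1; 1, 0] := rfl

lemma scalar_mem_center (z : Fˣ) :
    GeneralLinearGroup.scalar (Fin 2) z ∈ Subgroup.center (GL (Fin 2) F) := by
  rw [GeneralLinearGroup.center_eq_range_scalar]
  exact ⟨z, rfl⟩

lemma diagOne_inv_mul_upperRightHom_mul (δ : Fˣ) (x : F) :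
    (diagOne δ)⁻¹ * GeneralLinearGroup.upperRightHom x * diagOne δ =
      GeneralLinearGroup.upperRightHom (x * δ) := by
  rw [mul_assoc, inv_mul_eq_iff_eq_mul]
  ext i j
  fin_cases i <;> fin_cases j <;> simp [Matrix.mul_apply, Fin.sum_univ_two, diagOne_val]

/-- A character trivial on `Z` and on the Weyl element therefore squares to `1` on `diag(1, δ)`. -/
lemma diagOne_mul_weyl_conj (δ : Fˣ) :
    diagOne δ * (weyl F * diagOne δ * weyl F) = GeneralLinearGroup.scalar (Fin 2) δ := by
  ext i j
  fin_cases i <;> fin_cases j <;>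
    simp [Matrix.mul_apply, Fin.sum_univ_two, diagOne_val, weyl_val, GeneralLinearGroup.scalar]

variable [ValuativeRel F]

lemma integer_isUnit_iff (x : 𝒪[F]) : IsUnit x ↔ valuation F x = 1 :=
  (Valuation.integer.integers (valuation F)).isUnit_iff_valuation_eq_one

lemma mem_maximalIdeal_integer_iff (x : 𝒪[F]) :
    x ∈ IsLocalRing.maximalIdeal 𝒪[F] ↔ valuation F x < 1 := by
  rw [IsLocalRing.mem_maximalIdeal, mem_nonunits_iff, integer_isUnit_iff]
  exact ⟨fun h => lt_of_le_of_ne x.2 h, fun h => h.ne⟩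

lemma integralInclusion_apply (κ : GL (Fin 2) 𝒪[F]) (i j : Fin 2) :
    integralInclusion F κ i j = (κ i j : F) := rfl

lemma integralInclusion_weyl : integralInclusion F (weyl 𝒪[F]) = weyl F := by
  ext i j
  rw [integralInclusion_apply]
  fin_cases i <;> fin_cases j <;> simp [weyl_val]

lemma integralInclusion_upperRightHom (x : 𝒪[F]) :
    integralInclusion F (GeneralLinearGroup.upperRightHom x) =
      GeneralLinearGroup.upperRightHom (x : F) := by
  ext i j
  rw [integralInclusion_apply]
  fin_cases i <;> fin_cases j <;> simp

lemma integralReduction_upperRightHom (x : 𝒪[F]) :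
    integralReduction F (GeneralLinearGroup.upperRightHom x) =
      GeneralLinearGroup.upperRightHom (IsLocalRing.residue 𝒪[F] x) := by
  ext i j
  fin_cases i <;> fin_cases j <;> simp [integralReduction]

/-- The Cartan decomposition, for matrices whose upper left entry is maximal. -/
lemma exists_cartan_of_maximal (g : GL (Fin 2) F)
    (hmax : ∀ i j, valuation F (g i j) ≤ valuation F (g 0 0)) :
    ∃ (z : Fˣ) (k₁ k₂ : GL (Fin 2) 𝒪[F]) (δ : Fˣ), valuation F δ ≤ 1 ∧
      g = GeneralLinearGroup.scalar (Fin 2) z * integralInclusion F k₁ * diagOne δ *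
        integralInclusion F k₂ := by
  have hdet := g.det_ne_zero
  have ha : g 0 0 ≠ 0 := by
    intro h0
    have : ∀ i j, g i j = 0 := fun i j => by
      have := hmax i j
      rw [h0, map_zero] at this
      exact (map_eq_zero _).mp (le_zero_iff.mp this)
    exact hdet (by rw [Matrix.det_fin_two, this, this 0 1]; ring)
  have hva : 0 < valuation F (g 0 0) := zero_lt_iff.mpr ((map_ne_zero _).mpr ha)
  have hquot : ∀ i j, valuation F (g i j / g 0 0) ≤ 1 := fun i j => by
    rw [map_div₀]
    exact div_le_one_of_le₀ (hmax i j) hva.le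
  let b : 𝒪[F] := ⟨g 0 1 / g 0 0, hquot 0 1⟩
  let c : 𝒪[F] := ⟨g 1 0 / g 0 0, hquot 1 0⟩
  let d : 𝒪[F] := ⟨g 1 1 / g 0 0, hquot 1 1⟩
  have hδ : ((d - b * c : 𝒪[F]) : F) ≠ 0 := by
    change g 1 1 / g 0 0 - g 0 1 / g 0 0 * (g 1 0 / g 0 0) ≠ 0
    intro h
    apply hdet
    rw [Matrix.det_fin_two]
    field_simp at h
    linear_combination h
  let k₁ : GL (Fin 2) 𝒪[F] :=
    ⟨!![1, 0; c, 1], !![1, 0; -c, 1], by simp [one_fin_two], by simp [one_fin_two]⟩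
  have hk₁ : (k₁ : Matrix (Fin 2) (Fin 2) 𝒪[F]) = !![1, 0; c, 1] := rfl
  -- Elimination with the largest entry as pivot keeps the multipliers `b`, `c` and `δ = d - bc`
  -- integral.
  refine ⟨Units.mk0 _ ha, k₁, GeneralLinearGroup.upperRightHom b, Units.mk0 _ hδ,
    (d - b * c).2, ?_⟩
  rw [integralInclusion_upperRightHom]
  ext i j
  fin_cases i <;> fin_cases j <;>
    simp [Matrix.mul_apply, Fin.sum_univ_two, integralInclusion_apply, hk₁, diagOne_val,
      GeneralLinearGroup.scalar, b, c, d] <;> field_simp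
  ring

/-- The Cartan decomposition of `GL(2, F)`. -/
lemma exists_cartan (g : GL (Fin 2) F) :
    ∃ (z : Fˣ) (k₁ k₂ : GL (Fin 2) 𝒪[F]) (δ : Fˣ), valuation F δ ≤ 1 ∧
      g = GeneralLinearGroup.scalar (Fin 2) z * integralInclusion F k₁ * diagOne δ *
        integralInclusion F k₂ := by
  obtain ⟨⟨i, j⟩, -, hij⟩ := Finset.exists_max_image (Finset.univ : Finset (Fin 2 × Fin 2))
    (fun p => valuation F (g p.1 p.2)) ⟨(0, 0), Finset.mem_univ _⟩
  have hcol : ∀ g' : GL (Fin 2) F, (∀ i' j', valuation F (g' i' j') ≤ valuation F (g' 0 j)) →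
      ∃ (z : Fˣ) (k₁ k₂ : GL (Fin 2) 𝒪[F]) (δ : Fˣ), valuation F δ ≤ 1 ∧
      g' = GeneralLinearGroup.scalar (Fin 2) z * integralInclusion F k₁ * diagOne δ *
        integralInclusion F k₂ := by
    intro g' hg'
    fin_cases j
    · exact exists_cartan_of_maximal g' hg'
    · obtain ⟨z, k₁, k₂, δ, hδ, h⟩ := exists_cartan_of_maximal (g' * weyl F) (fun i' j' => by
        have h1 := hg' i' 0
        have h2 := hg' i' 1
        fin_cases j' <;> simpa [Matrix.mul_apply, Fin.sum_univ_two, weyl_val])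
      refine ⟨z, k₁, k₂ * (weyl _)⁻¹, δ, hδ, ?_⟩
      rw [map_mul, map_inv, integralInclusion_weyl, ← mul_assoc, ← h, mul_inv_cancel_right]
  fin_cases i
  · exact hcol g fun i' j' => hij (i', j') (Finset.mem_univ _)
  · obtain ⟨z, k₁, k₂, δ, hδ, h⟩ := hcol (weyl F * g) (fun i' j' => by
      have h1 := hij (0, j') (Finset.mem_univ _)
      have h2 := hij (1, j') (Finset.mem_univ _)
      fin_cases i' <;> simpa [Matrix.mul_apply, Fin.sum_univ_two, weyl_val])
    refine ⟨z, (weyl _)⁻¹ * k₁, k₂, δ, hδ, ?_⟩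
    have hz : Commute (weyl F)⁻¹ (GeneralLinearGroup.scalar (Fin 2) z) :=
      Subgroup.mem_center_iff.mp (scalar_mem_center z) _
    rw [map_mul, map_inv, integralInclusion_weyl, ← mul_assoc, ← hz.eq, mul_assoc, mul_assoc,
      mul_assoc, ← mul_assoc (GeneralLinearGroup.scalar (Fin 2) z), ← mul_assoc
      (GeneralLinearGroup.scalar (Fin 2) z * _), ← h, inv_mul_cancel_left]

/-- The kernel of the reduction map, as a subgroup of `GL(2, F)`. -/
def congruenceSubgroup (F : Type*) [Field F] [ValuativeRel F] : Subgroup (GL (Fin 2) F) :=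
  (integralReduction F).ker.map (integralInclusion F)

lemma scalar_mem_subgroupZK (z : Fˣ) : GeneralLinearGroup.scalar (Fin 2) z ∈ subgroupZK F :=
  ⟨(z, 1), by simp [centerMulK]⟩

lemma integralInclusion_mem_subgroupZK (κ : GL (Fin 2) 𝒪[F]) :
    integralInclusion F κ ∈ subgroupZK F :=
  ⟨(1, κ), by simp [centerMulK]⟩

lemma diagOne_mem_subgroupZK {δ : Fˣ} (hδ : valuation F δ = 1) : diagOne δ ∈ subgroupZK F := by
  have hδ' : valuation F ((δ⁻¹ : Fˣ) : F) = 1 := by simp [hδ]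
  let κ : GL (Fin 2) 𝒪[F] := ⟨!![1, 0; 0, ⟨δ, hδ.le⟩], !![1, 0; 0, ⟨(δ⁻¹ : Fˣ), hδ'.le⟩],
    by ext i j; fin_cases i <;> fin_cases j <;> simp,
    by ext i j; fin_cases i <;> fin_cases j <;> simp⟩
  have : integralInclusion F κ = diagOne δ := by
    ext i j
    rw [integralInclusion_apply]
    fin_cases i <;> fin_cases j <;> simp [κ, diagOne_val]
  rw [← this]
  exact integralInclusion_mem_subgroupZK κ

section Rep

variable {W : Type*} [AddCommGroup W] [Module ℂ W]
  {σ : Representation ℂ (GL (Fin 2) 𝓀[F]) W} {ω : Fˣ →* Circle} (hω : ExtendsCentralChar σ ω)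

lemma extendToZK_integralInclusion (κ : GL (Fin 2) 𝒪[F])
    (h : integralInclusion F κ ∈ subgroupZK F) :
    extendToZK σ ω hω ⟨integralInclusion F κ, h⟩ = σ (integralReduction F κ) := by
  have := extendToZK_apply σ ω hω 1 κ
  rw [map_one, Circle.coe_one, one_smul] at this
  rw [← this]
  congr 2
  simp [centerMulK]

lemma extendToZK_scalar (z : Fˣ) (h : GeneralLinearGroup.scalar (Fin 2) z ∈ subgroupZK F) :
    extendToZK σ ω hω ⟨GeneralLinearGroup.scalar (Fin 2) z, h⟩ = (ω z : ℂ) • 1 := by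
  have := extendToZK_apply σ ω hω z 1
  rw [map_one, map_one] at this
  rw [← this]
  congr 2
  simp [centerMulK]

lemma sum_upperRightHom_eq_zero [Fintype 𝓀[F]] (hσ : IsCuspidalRep σ) :
    ∑ x : 𝓀[F], σ (GeneralLinearGroup.upperRightHom x) = 0 := by
  ext w
  refine hσ.no_fixed _ fun y => ?_
  rw [← Module.End.mul_apply, Finset.mul_sum]
  simp_rw [← map_mul, ← AddChar.map_add_eq_mul]
  exact LinearMap.congr_fun (Equiv.sum_comp (Equiv.addLeft y)
    fun x => σ (GeneralLinearGroup.upperRightHom x)) w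

/-- If the conjugates of the integral unipotent matrices under `diag(1, δ) k₂` lie in `U`, then
so do sufficiently many conjugates of elements of `Z K` under `z k₁ diag(1, δ) k₂`. -/
lemma exists_sum_extendToZK_eq_zero [Finite 𝓀[F]] (hσ : IsCuspidalRep σ) (z : Fˣ)
    (k₁ k₂ : GL (Fin 2) 𝒪[F]) (δ : Fˣ) (U : Subgroup (GL (Fin 2) F))
    (hU : ∀ x : 𝒪[F], (integralInclusion F k₂)⁻¹ *
      GeneralLinearGroup.upperRightHom ((x : F) * δ) * integralInclusion F k₂ ∈ U) :
    ∃ S : Finset (subgroupZK F), S.Nonempty ∧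
      (∀ h ∈ S, (GeneralLinearGroup.scalar (Fin 2) z * integralInclusion F k₁ * diagOne δ *
        integralInclusion F k₂)⁻¹ * h * (GeneralLinearGroup.scalar (Fin 2) z *
        integralInclusion F k₁ * diagOne δ * integralInclusion F k₂) ∈ U) ∧
      ∑ h ∈ S, extendToZK σ ω hω h = 0 := by
  classical
  have := Fintype.ofFinite 𝓀[F]
  choose lift hlift using IsLocalRing.residue_surjective (R := 𝒪[F])
  -- One lift for each residue class: the reductions run over a conjugate of `N(𝔽_q)`, on which `σ`
  -- sums to zero.
  let κ : 𝓀[F] → GL (Fin 2) 𝒪[F] := fun x =>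
    k₁ * GeneralLinearGroup.upperRightHom (lift x) * k₁⁻¹
  let s : 𝓀[F] → subgroupZK F := fun x =>
    ⟨integralInclusion F (κ x), integralInclusion_mem_subgroupZK _⟩
  have hred : ∀ x, integralReduction F (κ x) = integralReduction F k₁ *
      GeneralLinearGroup.upperRightHom x * (integralReduction F k₁)⁻¹ := fun x => by
    simp only [κ, map_mul, map_inv, integralReduction_upperRightHom, hlift]
  have hs : Function.Injective s := fun x y hxy => by
    have h1 : integralInclusion F (κ x) = integralInclusion F (κ y) := congrArg Subtype.val hxy
    simp only [κ, map_mul, map_inv, integralInclusion_upperRightHom] at h1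
    have h2 := GeneralLinearGroup.injective_upperRightHom (mul_left_cancel (mul_right_cancel h1))
    rw [← hlift x, ← hlift y, Subtype.ext h2]
  refine ⟨Finset.univ.image s, Finset.univ_nonempty.image _, ?_, ?_⟩
  · simp only [Finset.mem_image, Finset.mem_univ, true_and]
    rintro _ ⟨x, rfl⟩
    have hz := Subgroup.mem_center_iff.mp (scalar_mem_center z) (integralInclusion F (κ x))
    convert hU (lift x) using 1
    rw [← diagOne_inv_mul_upperRightHom_mul]
    change _ * integralInclusion F (κ x) * _ = _
    have hz' : (GeneralLinearGroup.scalar (Fin 2) z)⁻¹ * integralInclusion F (κ x) *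
        GeneralLinearGroup.scalar (Fin 2) z = integralInclusion F (κ x) := by
      rw [mul_assoc, hz, inv_mul_cancel_left]
    calc _ = (integralInclusion F k₂)⁻¹ * ((diagOne δ)⁻¹ * ((integralInclusion F k₁)⁻¹ *
        ((GeneralLinearGroup.scalar (Fin 2) z)⁻¹ * integralInclusion F (κ x) *
        GeneralLinearGroup.scalar (Fin 2) z) * integralInclusion F k₁) * diagOne δ) *
        integralInclusion F k₂ := by group
      _ = _ := by
        rw [hz']
        simp only [κ, map_mul, map_inv, integralInclusion_upperRightHom]
        group
  · rw [Finset.sum_image fun x _ y _ h => hs h]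
    simp only [s, extendToZK_integralInclusion, hred, map_mul]
    rw [← Finset.sum_mul, ← Finset.mul_sum, sum_upperRightHom_eq_zero hσ, mul_zero, zero_mul]

end Rep

end LocalField

/-! ### Topology of `GL(2, F)`, cuspidality of the inducing datum, and unimodularity. -/

section LocalFieldTopology

variable {F : Type*} [Field F] [ValuativeRel F]

lemma congruenceSubgroup_le : congruenceSubgroup F ≤ subgroupZK F := by
  rintro _ ⟨κ, -, rfl⟩
  exact integralInclusion_mem_subgroupZK κ

lemma image_subgroupZK :
    (fun g : GL (Fin 2) F => (g : GL (Fin 2) F ⧸ Subgroup.center (GL (Fin 2) F)))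
    '' (subgroupZK F : Set (GL (Fin 2) F)) =
    Set.range fun κ => ((integralInclusion F κ : GL (Fin 2) F) :
      GL (Fin 2) F ⧸ Subgroup.center (GL (Fin 2) F)) := by
  ext x
  constructor
  · rintro ⟨_, ⟨⟨z, κ⟩, rfl⟩, rfl⟩
    refine ⟨κ, ?_⟩
    have : ((GeneralLinearGroup.scalar (Fin 2) z : GL (Fin 2) F) :
        GL (Fin 2) F ⧸ Subgroup.center (GL (Fin 2) F)) = 1 :=
      (QuotientGroup.eq_one_iff _).mpr (scalar_mem_center z)
    change _ = ((GeneralLinearGroup.scalar (Fin 2) z * integralInclusion F κ : GL (Fin 2) F) :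
      GL (Fin 2) F ⧸ Subgroup.center (GL (Fin 2) F))
    rw [QuotientGroup.mk_mul, this, one_mul]
  · rintro ⟨κ, rfl⟩
    exact ⟨_, integralInclusion_mem_subgroupZK κ, rfl⟩

lemma integralReduction_surjective : Function.Surjective (integralReduction F) := by
  intro g
  choose lift hlift using IsLocalRing.residue_surjective (R := 𝒪[F])
  let M : Matrix (Fin 2) (Fin 2) 𝒪[F] := Matrix.of fun i j => lift (g i j)
  have hM : (IsLocalRing.residue 𝒪[F]).mapMatrix M = g := by
    ext i j
    exact hlift _
  have hdet : IsUnit M.det := by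
    rw [← isUnit_map_iff (IsLocalRing.residue 𝒪[F]), RingHom.map_det, hM]
    exact (GeneralLinearGroup.det g).isUnit
  exact ⟨GeneralLinearGroup.mk'' M hdet, Units.ext hM⟩

lemma irreducible_extendToZK {W : Type*} [AddCommGroup W] [Module ℂ W]
    {σ : Representation ℂ (GL (Fin 2) 𝓀[F]) W} {ω : Fˣ →* Circle}
    (hω : ExtendsCentralChar σ ω) (hσ : σ.IsIrreducible) :
    (extendToZK σ ω hω).IsIrreducible := by
  refine { exists_pair_ne := ⟨⊥, ⊤, fun h => ?_⟩, eq_bot_or_eq_top := fun Y => ?_ }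
  · have h' : (⊥ : Submodule ℂ W) = ⊤ := congrArg Subrepresentation.toSubmodule h
    obtain ⟨S, T, hST⟩ := hσ.exists_pair_ne
    have := (Submodule.subsingleton_iff ℂ).mp (subsingleton_of_bot_eq_top h')
    exact hST (Subrepresentation.toSubmodule_injective (Subsingleton.elim _ _))
  · let Y' : Subrepresentation σ := ⟨Y.toSubmodule, fun g w hw => by
      obtain ⟨κ, rfl⟩ := integralReduction_surjective g
      rw [← extendToZK_integralInclusion hω κ (integralInclusion_mem_subgroupZK κ)]
      exact Y.apply_mem_toSubmodule _ hw⟩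
    refine (hσ.eq_bot_or_eq_top Y').imp (fun h => ?_) (fun h => ?_)
    · exact Subrepresentation.toSubmodule_injective (congrArg Subrepresentation.toSubmodule h :)
    · exact Subrepresentation.toSubmodule_injective (congrArg Subrepresentation.toSubmodule h :)

/-- Conditions on both `g` and `g⁻¹` make both matrices integral, and they are open conditions in
the topology of a unit group. -/
lemma mem_congruenceSubgroup_of_lt {g : GL (Fin 2) F}
    (h : ∀ i j, valuation F ((g : Matrix (Fin 2) (Fin 2) F) i j - (1 : Matrix _ _ F) i j) < 1)
    (h' : ∀ i j, valuation F ((g⁻¹ : GL (Fin 2) F) i j - (1 : Matrix (Fin 2) (Fin 2) F) i j) < 1) :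
    g ∈ congruenceSubgroup F := by
  have h1 : ∀ i j, valuation F ((1 : Matrix (Fin 2) (Fin 2) F) i j) ≤ 1 := fun i j => by
    rw [Matrix.one_apply]
    split_ifs <;> simp
  have hint : ∀ g' : GL (Fin 2) F,
      (∀ i j, valuation F (g' i j - (1 : Matrix (Fin 2) (Fin 2) F) i j) < 1) →
      ∀ i j, valuation F (g' i j) ≤ 1 := fun g' hg' i j => by
    rw [← sub_add_cancel (g' i j) ((1 : Matrix (Fin 2) (Fin 2) F) i j)]
    exact (Valuation.map_add _ _ _).trans (max_le (hg' i j).le (h1 i j))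
  let κ : GL (Fin 2) 𝒪[F] :=
    ⟨Matrix.of fun i j => ⟨g i j, hint g h i j⟩, Matrix.of fun i j => ⟨g⁻¹ i j, hint _ h' i j⟩,
      by
        ext i j
        have := congrArg (fun M : GL (Fin 2) F => M i j) (mul_inv_cancel g)
        rw [Units.val_mul, Matrix.mul_apply, Units.val_one] at this
        rw [Matrix.mul_apply, Matrix.one_apply]
        simpa [Matrix.one_apply, apply_ite] using this,
      by
        ext i j
        have := congrArg (fun M : GL (Fin 2) F => M i j) (inv_mul_cancel g)
        rw [Units.val_mul, Matrix.mul_apply, Units.val_one] at this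
        rw [Matrix.mul_apply, Matrix.one_apply]
        simpa [Matrix.one_apply, apply_ite] using this⟩
  refine ⟨κ, MonoidHom.mem_ker.mpr ?_, ?_⟩
  · ext i j
    have hm : κ i j - (1 : Matrix (Fin 2) (Fin 2) 𝒪[F]) i j ∈ IsLocalRing.maximalIdeal 𝒪[F] := by
      rw [mem_maximalIdeal_integer_iff]
      have := h i j
      rw [Matrix.one_apply] at this ⊢
      convert this using 2
      split_ifs <;> rfl
    have := (IsLocalRing.residue_eq_zero_iff _).mpr hm
    rw [map_sub, sub_eq_zero] at this
    change IsLocalRing.residue 𝒪[F] (κ i j) = _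
    rw [this, Matrix.one_apply, Units.val_one, Matrix.one_apply]
    split_ifs <;> simp
  · ext i j
    rfl

variable [TopologicalSpace F]

lemma continuous_integralInclusion : Continuous (integralInclusion F) :=
  Continuous.generalLinearGroup_map (f := 𝒪[F].subtype) continuous_subtype_val

section Valuative

variable [IsValuativeTopology F]

lemma isOpen_valuation_lt (y : F) : IsOpen {x : F | valuation F x < valuation F y} := by
  simpa using Valuation.isOpen_ball (v := valuation F) ((valuation F).restrict y)

instance IsValuativeTopology.t2Space : T2Space F :=
  IsTopologicalAddGroup.t2Space_of_zero_sep fun x hx =>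
    ⟨{y | valuation F y < valuation F x}, (isOpen_valuation_lt x).mem_nhds
      (by simpa using zero_lt_iff.mpr ((map_ne_zero (valuation F)).mpr hx)), fun h =>
      lt_irrefl (valuation F x) h⟩

end Valuative

variable [IsNonarchimedeanLocalField F]

instance locallyCompactSpace_GL : LocallyCompactSpace (GL (Fin 2) F) :=
  have : LocallyCompactSpace (Matrix (Fin 2) (Fin 2) F) :=
    inferInstanceAs (LocallyCompactSpace (Fin 2 → Fin 2 → F))
  inferInstanceAs (LocallyCompactSpace (Matrix (Fin 2) (Fin 2) F)ˣ)

instance compactSpace_GL_integer : CompactSpace (GL (Fin 2) 𝒪[F]) :=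
  have : CompactSpace (Matrix (Fin 2) (Fin 2) 𝒪[F]) :=
    inferInstanceAs (CompactSpace (Fin 2 → Fin 2 → 𝒪[F]))
  inferInstanceAs (CompactSpace (Matrix (Fin 2) (Fin 2) 𝒪[F])ˣ)

lemma continuous_diagOne : Continuous (diagOne : Fˣ → GL (Fin 2) F) := by
  refine Units.continuous_iff.mpr
    ⟨continuous_matrix fun i j => ?_, continuous_matrix fun i j => ?_⟩
  · fin_cases i <;> fin_cases j
    exacts [continuous_const, continuous_const, continuous_const, Units.continuous_val]
  · fin_cases i <;> fin_cases j
    exacts [continuous_const, continuous_const, continuous_const,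
      Units.continuous_val.comp continuous_inv]

lemma isOpen_congruenceSubgroup : IsOpen (congruenceSubgroup F : Set (GL (Fin 2) F)) := by
  refine Subgroup.isOpen_of_mem_nhds _ (g := 1) ?_
  have hb : ∀ i j, IsOpen {x : F | valuation F (x - (1 : Matrix (Fin 2) (Fin 2) F) i j) < 1} :=
    fun i j => by
      have := (isOpen_valuation_lt (1 : F)).preimage
        (continuous_sub_right ((1 : Matrix (Fin 2) (Fin 2) F) i j))
      rwa [map_one] at this
  have h1 : IsOpen {g : GL (Fin 2) F | ∀ i j,
      valuation F (g i j - (1 : Matrix (Fin 2) (Fin 2) F) i j) < 1} := by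
    simp only [Set.ofPred_forall]
    refine isOpen_iInter_of_finite fun i => isOpen_iInter_of_finite fun j => (hb i j).preimage ?_
    exact Units.continuous_val.matrix_elem i j
  have h2 := h1.preimage (continuous_inv (G := GL (Fin 2) F))
  refine Filter.mem_of_superset ((h1.inter h2).mem_nhds ⟨?_, ?_⟩)
    fun g hg => mem_congruenceSubgroup_of_lt hg.1 hg.2
  · simp
  · simp

lemma isCompact_congruenceSubgroup : IsCompact (congruenceSubgroup F : Set (GL (Fin 2) F)) := by
  refine (isCompact_range continuous_integralInclusion).of_isClosed_subset
    (Subgroup.isClosed_of_isOpen _ isOpen_congruenceSubgroup) ?_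
  rintro _ ⟨κ, -, rfl⟩
  exact ⟨κ, rfl⟩

lemma isCompact_imageKModZ : IsCompact (imageKModZ F) := by
  rw [imageKModZ, image_subgroupZK]
  exact isCompact_range (continuous_quot_mk.comp continuous_integralInclusion)

lemma continuous_conj_upperRightHom :
    Continuous fun p : F × GL (Fin 2) 𝒪[F] => (integralInclusion F p.2)⁻¹ *
      GeneralLinearGroup.upperRightHom p.1 * integralInclusion F p.2 := by
  have h1 : Continuous fun p : F × GL (Fin 2) 𝒪[F] => integralInclusion F p.2 :=
    continuous_integralInclusion.comp continuous_snd
  have h2 : Continuous fun p : F × GL (Fin 2) 𝒪[F] =>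
      (GeneralLinearGroup.upperRightHom p.1 : GL (Fin 2) F) :=
    GeneralLinearGroup.continuous_upperRightHom.comp continuous_fst
  exact (h1.inv.mul h2).mul h1

/-- Conjugates of small unipotent matrices by elements of the compact group `K` lie in a given open
subgroup. -/
lemma exists_conj_upperRightHom_mem {U : Subgroup (GL (Fin 2) F)}
    (hU : IsOpen (U : Set (GL (Fin 2) F))) :
    ∃ y : F, y ≠ 0 ∧ ∀ x : F, valuation F x < valuation F y → ∀ κ : GL (Fin 2) 𝒪[F],
      (integralInclusion F κ)⁻¹ * GeneralLinearGroup.upperRightHom x *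
        integralInclusion F κ ∈ U := by
  have h0 : ({0} : Set F) ×ˢ (Set.univ : Set (GL (Fin 2) 𝒪[F])) ⊆
      (fun p : F × GL (Fin 2) 𝒪[F] => (integralInclusion F p.2)⁻¹ *
        GeneralLinearGroup.upperRightHom p.1 * integralInclusion F p.2) ⁻¹' U := by
    intro p hp
    rw [Set.mem_preimage, Set.mem_singleton_iff.mp hp.1, AddChar.map_zero_eq_one, mul_one,
      inv_mul_cancel]
    exact U.one_mem
  obtain ⟨u, v, hu, -, h0u, hv, huv⟩ := generalized_tube_lemma isCompact_singleton isCompact_univ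
    (hU.preimage continuous_conj_upperRightHom) h0
  obtain ⟨γ, hγ, hγu⟩ := (IsValuativeTopology.hasBasis_nhds_zero' F).mem_iff.mp
    (hu.mem_nhds (h0u (Set.mem_singleton 0)))
  obtain ⟨y, hy⟩ := ValuativeRel.valuation_surjective γ
  have hy0 : y ≠ 0 := by
    rintro rfl
    exact hγ (hy.symm.trans (map_zero _))
  refine ⟨y, hy0, fun x hx κ => ?_⟩
  have hxu : x ∈ u := hγu (Set.mem_ofPred_eq ▸ hy ▸ hx)
  have h := huv (Set.mk_mem_prod hxu (hv (Set.mem_univ κ)))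
  rw [Set.mem_preimage] at h
  exact h

lemma isCompact_units_annulus {y : F} (hy : y ≠ 0) :
    IsCompact {δ : Fˣ | valuation F (δ : F) ≤ 1 ∧ ¬ valuation F (δ : F) < valuation F y} := by
  rw [Units.isEmbedding_val₀.isCompact_iff]
  have : (Units.val '' {δ : Fˣ | valuation F (δ : F) ≤ 1 ∧
      ¬ valuation F (δ : F) < valuation F y}) =
      {x : F | valuation F x ≤ 1} ∩ {x | valuation F x < valuation F y}ᶜ := by
    ext x
    constructor
    · rintro ⟨δ, h, rfl⟩
      exact h
    · rintro ⟨h1, h2⟩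
      have hx : x ≠ 0 := by
        rintro rfl
        apply h2
        simpa using zero_lt_iff.mpr ((map_ne_zero (valuation F)).mpr hy)
      exact ⟨Units.mk0 x hx, ⟨h1, h2⟩, rfl⟩
  rw [this]
  exact (IsNonarchimedeanLocalField.isCompact_closedBall F 1).inter_right
    (isOpen_valuation_lt y).isClosed_compl

-- Conjugation by `diag(1, δ)` multiplies the unipotent parameter by `δ`. For `|δ| < 1` the result
-- reduces to the identity modulo `𝔭`; for `δ` small enough it enters any given open subgroup,
-- uniformly in `k₂` because `K` is compact.
open scoped Pointwise in
theorem isCuspidalInducing_extendToZK {W : Type*} [AddCommGroup W] [Module ℂ W]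
    {σ : Representation ℂ (GL (Fin 2) 𝓀[F]) W} {ω : Fˣ →* Circle}
    (hω : ExtendsCentralChar σ ω) (hσ : IsCuspidalRep σ) :
    IsCuspidalInducing (subgroupZK F) (congruenceSubgroup F) (extendToZK σ ω hω) where
  isOpen := isOpen_congruenceSubgroup
  isCompact := isCompact_congruenceSubgroup
  le := congruenceSubgroup_le
  trivial_on := by
    rintro ⟨_, h⟩ ⟨κ, hκ, rfl⟩
    rw [extendToZK_integralInclusion, MonoidHom.mem_ker.mp hκ, map_one]
  irreducible := irreducible_extendToZK hω hσ.irreducible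
  center_le := by
    rw [GeneralLinearGroup.center_eq_range_scalar]
    rintro _ ⟨z, rfl⟩
    exact scalar_mem_subgroupZK z
  central := by
    rintro ⟨z, hz'⟩ hz
    rw [GeneralLinearGroup.center_eq_range_scalar] at hz
    obtain ⟨a, rfl⟩ := hz
    exact ⟨ω a, Circle.norm_coe _, extendToZK_scalar hω a hz'⟩
  compact_mod := isCompact_imageKModZ
  exists_sum_eq_zero := by
    intro g hg
    obtain ⟨z, k₁, k₂, δ, hδ, rfl⟩ := exists_cartan g
    refine exists_sum_extendToZK_eq_zero hω hσ z k₁ k₂ δ _ fun x => ?_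
    have hδ1 : valuation F (δ : F) < 1 := lt_of_le_of_ne hδ fun h => hg
      (mul_mem (mul_mem (mul_mem (scalar_mem_subgroupZK z) (integralInclusion_mem_subgroupZK k₁))
        (diagOne_mem_subgroupZK h)) (integralInclusion_mem_subgroupZK k₂))
    have hx : valuation F ((x : F) * δ) < 1 := by
      rw [map_mul]
      exact (mul_le_of_le_one_left' x.2).trans_lt hδ1
    let d : 𝒪[F] := ⟨(x : F) * δ, hx.le⟩
    have hd : IsLocalRing.residue 𝒪[F] d = 0 :=
      (IsLocalRing.residue_eq_zero_iff _).mpr ((mem_maximalIdeal_integer_iff d).mpr hx)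
    refine ⟨k₂⁻¹ * GeneralLinearGroup.upperRightHom d * k₂, MonoidHom.mem_ker.mpr ?_, ?_⟩
    · rw [map_mul, map_mul, integralReduction_upperRightHom, hd, AddChar.map_zero_eq_one, mul_one,
        ← map_mul, inv_mul_cancel, map_one]
    · rw [map_mul, map_mul, map_inv, integralInclusion_upperRightHom]
  exists_compact := by
    intro U hU
    obtain ⟨y, hy, hyU⟩ := exists_conj_upperRightHom_mem hU
    -- The Cartan parameters `δ` that are not small enough form a compact annulus in `Fˣ`.
    refine ⟨diagOne '' {δ : Fˣ | valuation F (δ : F) ≤ 1 ∧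
      ¬ valuation F (δ : F) < valuation F y} * Set.range (integralInclusion F),
      ((isCompact_units_annulus hy).image continuous_diagOne).mul
        (isCompact_range continuous_integralInclusion), fun g => ?_⟩
    obtain ⟨z, k₁, k₂, δ, hδ, rfl⟩ := exists_cartan g
    by_cases h : valuation F (δ : F) < valuation F y
    · refine Or.inr (exists_sum_extendToZK_eq_zero hω hσ z k₁ k₂ δ _ fun x => hyU _ ?_ k₂)
      rw [map_mul]
      exact (mul_le_of_le_one_left' x.2).trans_lt h
    · exact Or.inl ⟨_, mul_mem (scalar_mem_subgroupZK z) (integralInclusion_mem_subgroupZK k₁),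
        _, Set.mul_mem_mul ⟨δ, ⟨hδ, h⟩, rfl⟩ ⟨k₂, rfl⟩, by simp only [mul_assoc]⟩

/-- Unimodularity of `PGL(2, F)`, in the form needed here. -/
lemma measure_translate_imageKModZ
    [MeasurableSpace (GL (Fin 2) F ⧸ Subgroup.center (GL (Fin 2) F))]
    [BorelSpace (GL (Fin 2) F ⧸ Subgroup.center (GL (Fin 2) F))]
    (μ : Measure (GL (Fin 2) F ⧸ Subgroup.center (GL (Fin 2) F))) [μ.IsHaarMeasure]
    (a : GL (Fin 2) F) :
    μ ((fun g : GL (Fin 2) F => (g : GL (Fin 2) F ⧸ Subgroup.center (GL (Fin 2) F))) ''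
      {g | g * a ∈ subgroupZK F}) = μ (imageKModZ F) := by
  let A : Subgroup (GL (Fin 2) F ⧸ Subgroup.center (GL (Fin 2) F)) :=
    (subgroupZK F).map (QuotientGroup.mk' _)
  have hAeq : (A : Set _) = imageKModZ F := rfl
  have hopen : IsOpen (A : Set (GL (Fin 2) F ⧸ Subgroup.center (GL (Fin 2) F))) :=
    QuotientGroup.isOpenMap_coe _ (Subgroup.isOpen_mono congruenceSubgroup_le
      isOpen_congruenceSubgroup)
  obtain ⟨h1, h2⟩ := modularCharacter_eq_one_of_mem μ hopen (hAeq ▸ isCompact_imageKModZ)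
  let χ : GL (Fin 2) F →* NNReal := Measure.modularCharacter.comp
    (QuotientGroup.mk' (Subgroup.center (GL (Fin 2) F)))
  have hχH : ∀ h ∈ subgroupZK F, χ h = 1 := fun h hh => h2 _ ⟨h, hh, rfl⟩
  have hχδ : ∀ δ, χ (diagOne δ) = 1 := fun δ => by
    have h := congrArg χ (diagOne_mul_weyl_conj δ)
    have hw : χ (weyl F) = 1 := by
      rw [← integralInclusion_weyl]
      exact hχH _ (integralInclusion_mem_subgroupZK _)
    rw [map_mul, map_mul, map_mul, hw, one_mul, mul_one, hχH _ (scalar_mem_subgroupZK δ),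
      ← sq] at h
    -- The modular character takes nonnegative values, so a value with square `1` is `1`.
    exact (pow_eq_one_iff_of_nonneg zero_le two_ne_zero).mp h
  have hχ : χ a = 1 := by
    obtain ⟨z, k₁, k₂, δ, -, rfl⟩ := exists_cartan a
    rw [map_mul, map_mul, map_mul, hχδ, hχH _ (scalar_mem_subgroupZK z),
      hχH _ (integralInclusion_mem_subgroupZK k₁), hχH _ (integralInclusion_mem_subgroupZK k₂)]
    simp
  have h3 := h1 (a : GL (Fin 2) F ⧸ Subgroup.center (GL (Fin 2) F))
  rw [show Measure.modularCharacter (a : GL (Fin 2) F ⧸ Subgroup.center (GL (Fin 2) F)) = 1 from hχ,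
    one_smul, hAeq] at h3
  rw [← h3]
  congr 1
  ext x
  constructor
  · rintro ⟨g, hg, rfl⟩
    exact ⟨g * a, hg, rfl⟩
  · rintro ⟨h, hh, hx⟩
    refine ⟨h * a⁻¹, by simpa using hh, ?_⟩
    beta_reduce
    rw [QuotientGroup.mk_mul, QuotientGroup.mk_inv]
    exact mul_inv_eq_of_eq_mul hx

end LocalFieldTopology

end

theorem proposition13p5 {F : Type*} [Field F] [ValuativeRel F] [TopologicalSpace F]
    [IsNonarchimedeanLocalField F]
    [MeasurableSpace (GL (Fin 2) F ⧸ Subgroup.center (GL (Fin 2) F))]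
    [BorelSpace (GL (Fin 2) F ⧸ Subgroup.center (GL (Fin 2) F))]
    (μ : Measure (GL (Fin 2) F ⧸ Subgroup.center (GL (Fin 2) F))) [μ.IsHaarMeasure]
    {V : Type*} [AddCommGroup V] [Module ℂ V] (π : Representation ℂ (GL (Fin 2) F) V)
    (hπ : IsDepthZeroCuspidal π) :
    (μ (imageKModZ F) = 1 → HasFormalDimension π μ ((Nat.card 𝓀[F] : ℝ) - 1)) ∧
    (μ (imageKModZ F) = ENNReal.ofReal (((Nat.card 𝓀[F] : ℝ) - 1) / 2) →
      HasFormalDimension π μ 2) := by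
  obtain ⟨n, σ, ω, hω, hσ, ⟨e⟩⟩ := hπ
  have := Fintype.ofFinite 𝓀[F]
  have hn := hσ.finrank_add_one
  rw [Module.finrank_fin_fun, ← Nat.card_eq_fintype_card] at hn
  have hq : 1 < Nat.card 𝓀[F] := Finite.one_lt_card
  have hn0 : n ≠ 0 := by omega
  have hnq : (Nat.card 𝓀[F] : ℝ) - 1 = n := by
    rw [← hn]; push_cast; ring
  have hnpos : (0 : ℝ) < n := by exact_mod_cast Nat.pos_of_ne_zero hn0
  have he : ∀ g v, e.toLinearEquiv (π g v) = compactInd (subgroupZK F) (extendToZK σ ω hω) g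
      (e.toLinearEquiv v) := fun g v =>
    LinearMap.congr_fun (e.isIntertwining' g) v
  have D := isCuspidalInducing_extendToZK hω hσ
  rw [hnq]
  refine ⟨fun hμ => ?_, fun hμ => ?_⟩
  -- Both parts check `n = d · μ(ZK/Z)` with `n = q - 1`: volume `1` gives `d = n`, and volume `n/2`
  -- gives `d = 2`.
  · refine .of_linearEquiv he (D.hasFormalDimension hnpos (measure_translate_imageKModZ μ) ?_ hn0)
    change (n : ℝ) = n * μ.real (imageKModZ F)
    rw [measureReal_def, hμ, ENNReal.toReal_one, mul_one]
  · refine .of_linearEquiv he (D.hasFormalDimension two_pos (measure_translate_imageKModZ μ) ?_ hn0)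
    change (n : ℝ) = 2 * μ.real (imageKModZ F)
    rw [measureReal_def, hμ, ENNReal.toReal_ofReal (by positivity)]
    ring
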